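/- **Setting.** Let $d\ge 1$ and $p\ge 1$ be integers. For vectors $r\in\mathbb R^d$ and sets $A\subseteq\mathbb R^d$ write $rA=\{(r_1a_1,\dots,r_da_d): a\in A\}$. Let $|\cdot|$ denote Lebesgue measure for subsets of $\mathbb R^d$ and cardinality for subsets of $\mathbb Z^d$. For sequences of vectors, $u_n=o(v_n)$ means $u_{n,\ell}/v_{n,\ell}\to 0$ for every $\ell=1,\dots,d$. *Index sets.* For each $n$ let $D_n=C_n\cap\mathbb Z^d$, where $C_n\subseteq\mathbb R^d$ is a union of $p$ convex bodies (compact convex sets with non-empty interior) and $|C_n|\to\infty$. Let $c_n=(c_{n,1},\dots,c_{n,d})$ be vectors with entries in $(0,\infty)$ such that $c_{n,\ell}\to\infty$ for every $\ell$, $c_{n,1}\cdots c_{n,d}\sim|C_n|$, and, for some $0<c<\infty$, $C_n\subseteq c_n[-c,c]^d$ for all $n$. *Boxes.* Let $(k_n)$ be a sequence of natural numbers, and put $t_n^\ell=\lfloor c_{n,\ell}/k_n^{1/d}\rfloor$ and $I_z^n=\prod_{\ell=1}^d[z_\ell t_n^\ell,(z_\ell+1)t_n^\ell)$ for $z\in\mathbb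 Z^d$. Let $D_n^+$ be the union of the sets $I_z^n\cap\mathbb Z^d$ over all $z$ with $I_z^n\cap C_n\ne\emptyset$. Let $K_n=\mathbb Z^d\cap c_n[-b,b]^d$, where $0<b<\infty$ is such that $D_n^+\subseteq K_n$ for all $n$ (when $k_n\ge1$ for all $n$, $b=c+1$ is one such choice). *Random field.* Let $(\xi_v)_{v\in\mathbb Z^d}$ be a stationary field of real random variables on a probability space. For $A\subseteq\mathbb Z^d$ write $M_\xi(A)=\max_{v\in A}\xi_v$, with $M_\xi(\emptyset)=-\infty$. Let $(x_n)$ be a sequence of real numbers. *Mixing condition $\mathcal D(x_n;K_n)$.* Suppose that there are a (coordinatewise, not necessarily strictly) increasing sequence of vectors $\gamma_n\in(0,\infty)^d$ with $\gamma_n=o(c_n)$, and real numbers $\alpha_n\to0$, such that for all $n$ $$\bigl|P(M_\xi(A\cup B)\le x_n)-P(M_\xi(A)\le x_n)\,P(M_\xi(B)\le x_n)\bigr|\le\alpha_n$$ for all sets $A,B\subseteq K_n$, at least one of which is a box, that are $\gamma_n$-separated, meaning that $B\cap\{a+\gamma_n u: a\in A,\ u\in\mathbb R^d,\ |u|\le1\}=\emptyset$,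 where $\gamma_n u$ is the coordinatewise product and $|u|$ is the Euclidean norm. *Growth of $k_n$.* Suppose that $k_n\to\infty$, $k_n\alpha_n\to0$ and $k_n^{1/d}\gamma_n=o(c_n)$. *Local condition $\mathcal D^\ell(x_n;k_n;\theta)$.* Let $\prec$ be the strict part of a translation invariant total order on $\mathbb Z^d$, and let $A_0^n=\{z\in\mathbb Z^d: |z_\ell|\le t_n^\ell \text{ for all }\ell,\ 0\prec z\}$. Suppose that $P(\xi_0>x_n)>0$ for all large $n$ and that, for some $\theta\in(0,1]$, $$P\bigl(M_\xi(A_0^n)\le x_n\mid\xi_0>x_n\bigr)\to\theta .$$ **Theorem.** Under these assumptions, for every $\tau\in[0,\infty)$, as $n\to\infty$, $$|D_n|\,P(\xi_0>x_n)\to\tau\qquad\text{if and only if}\qquad P\Bigl(\max_{v\in D_n}\xi_v\le x_n\Bigr)\to e^{-\theta\tau}.$$ -/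

import Mathlib

open MeasureTheory ProbabilityTheory Filter Topology Asymptotics Set
open scoped Pointwise

noncomputable section

namespace SpatialExtremes

/-! ### Geometry of the index sets -/

/-- A convex body in `ℝ^d`: a compact convex set with non-empty interior. -/
def IsConvexBody {d : ℕ} (A : Set (Fin d → ℝ)) : Prop :=
  Convex ℝ A ∧ IsCompact A ∧ (interior A).Nonempty

/-- A `p`-convex set: a union of `p` convex bodies. -/
def IsPConvex {d : ℕ} (p : ℕ) (A : Set (Fin d → ℝ)) : Prop :=
  ∃ B : Fin p → Set (Fin d → ℝ), (∀ i, IsConvexBody (B i)) ∧ A = ⋃ i, B i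

/-- The coordinatewise scaling `r A = {(r₁ a₁, …, r_d a_d) : a ∈ A}`. -/
def scale {d : ℕ} (r : Fin d → ℝ) (A : Set (Fin d → ℝ)) : Set (Fin d → ℝ) :=
  (fun a ℓ => r ℓ * a ℓ) '' A

/-- The cube `[-b, b]^d`. -/
def cube (d : ℕ) (b : ℝ) : Set (Fin d → ℝ) :=
  Set.Icc (fun _ => -b) (fun _ => b)

/-- The inclusion of `ℤ^d` into `ℝ^d`. -/
def toReal {d : ℕ} (v : Fin d → ℤ) : Fin d → ℝ := fun ℓ => (v ℓ : ℝ)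

/-- The lattice points `A ∩ ℤ^d` of a set `A ⊆ ℝ^d`. -/
def latticePoints {d : ℕ} (A : Set (Fin d → ℝ)) : Set (Fin d → ℤ) :=
  {v | toReal v ∈ A}

/-- The geometric assumption on the index sets `D n`, with associated `p`-convex sets `C n` and
scaling vectors `c n`. -/
structure GeometricAssumption {d : ℕ} (p : ℕ) (D : ℕ → Set (Fin d → ℤ))
    (C : ℕ → Set (Fin d → ℝ)) (c : ℕ → Fin d → ℝ) : Prop where
  pConvex : ∀ n, IsPConvex p (C n)
  index_eq : ∀ n, D n = latticePoints (C n)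
  volume_tendsto : Tendsto (fun n => (volume (C n)).toReal) atTop atTop
  scaling_pos : ∀ n ℓ, 0 < c n ℓ
  scaling_tendsto : ∀ ℓ, Tendsto (fun n => c n ℓ) atTop atTop
  scaling_prod : (fun n => ∏ ℓ, c n ℓ) ~[atTop] (fun n => (volume (C n)).toReal)
  subset_box : ∃ b : ℝ, 0 < b ∧ ∀ n, C n ⊆ scale (c n) (cube d b)

/-- The side lengths `t^ℓ = ⌊c_ℓ / k^{1/d}⌋` of the approximating boxes. -/
def boxSide {d : ℕ} (c : Fin d → ℝ) (k : ℕ) (ℓ : Fin d) : ℤ :=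
  ⌊c ℓ / (k : ℝ) ^ (1 / (d : ℝ))⌋

/-- The box `I_z = t (z + [0,1)^d) = ∏ [z_ℓ t^ℓ, (z_ℓ + 1) t^ℓ)`. -/
def gridBox {d : ℕ} (c : Fin d → ℝ) (k : ℕ) (z : Fin d → ℤ) : Set (Fin d → ℝ) :=
  {u | ∀ ℓ, (z ℓ : ℝ) * boxSide c k ℓ ≤ u ℓ ∧ u ℓ < ((z ℓ : ℝ) + 1) * boxSide c k ℓ}

/-- The outer approximation `D⁺`: the lattice points of all the boxes `I_z` that meet `C`. -/
def outerApprox {d : ℕ} (C : Set (Fin d → ℝ)) (c : Fin d → ℝ) (k : ℕ) : Set (Fin d → ℤ) :=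
  ⋃ z ∈ {z : Fin d → ℤ | (gridBox c k z ∩ C).Nonempty}, latticePoints (gridBox c k z)

/-- The surrounding box `ℤ^d ∩ c [-b, b]^d`. -/
def surroundingBox {d : ℕ} (c : Fin d → ℝ) (b : ℝ) : Set (Fin d → ℤ) :=
  latticePoints (scale c (cube d b))

/-! ### Random fields -/

/-- The field `ξ` is (strictly) stationary: every shift of it has the same law on `ℝ^(ℤ^d)`. -/
def IsStationary {d : ℕ} {Ω : Type*} [MeasurableSpace Ω] (P : Measure Ω)
    (ξ : (Fin d → ℤ) → Ω → ℝ) : Prop :=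
  ∀ w : Fin d → ℤ, P.map (fun ω v => ξ (v + w) ω) = P.map (fun ω v => ξ v ω)

/-- `M_ξ(A) = max_{v ∈ A} ξ_v`, in the extended reals, so that `M_ξ(∅) = -∞`. All the sets `A`
to which it is applied below are finite. -/
def fieldMax {d : ℕ} {Ω : Type*} (ξ : (Fin d → ℤ) → Ω → ℝ) (A : Set (Fin d → ℤ)) (ω : Ω) :
    EReal :=
  ⨆ v ∈ A, (ξ v ω : EReal)

/-- The probability `ℙ(M_ξ(A) ≤ x)`. -/
def probMaxLE {d : ℕ} {Ω : Type*} [MeasurableSpace Ω] (P : Measure Ω)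
    (ξ : (Fin d → ℤ) → Ω → ℝ) (A : Set (Fin d → ℤ)) (x : ℝ) : ℝ :=
  P.real {ω | fieldMax ξ A ω ≤ (x : EReal)}

/-- A box in `ℤ^d`. -/
def IsBox {d : ℕ} (A : Set (Fin d → ℤ)) : Prop :=
  ∃ a b : Fin d → ℤ, A = Set.Icc a b

/-- The closed Euclidean unit ball `B(1)` of `ℝ^d`. -/
def unitBall (d : ℕ) : Set (Fin d → ℝ) :=
  {u | ‖(WithLp.toLp 2 u : EuclideanSpace ℝ (Fin d))‖ ≤ 1}

/-- `A` and `B` are `γ`-separated: `B ⊆ (A ⊕ γ B(1))ᶜ`, with `⊕` the Minkowski sum. -/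
def IsSeparated {d : ℕ} (γ : Fin d → ℝ) (A B : Set (Fin d → ℤ)) : Prop :=
  toReal '' B ⊆ (toReal '' A + scale γ (unitBall d))ᶜ

/-- The mixing condition `𝒟(x_n; K_n)`, holding with the vectors `γ n` and the rates `α n`
(`c` is the sequence of scaling vectors). -/
structure MixingCondition {d : ℕ} {Ω : Type*} [MeasurableSpace Ω] (P : Measure Ω)
    (ξ : (Fin d → ℤ) → Ω → ℝ) (c : ℕ → Fin d → ℝ) (x : ℕ → ℝ) (K : ℕ → Set (Fin d → ℤ))
    (γ : ℕ → Fin d → ℝ) (α : ℕ → ℝ) : Prop where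
  gap_pos : ∀ n ℓ, 0 < γ n ℓ
  gap_mono : Monotone γ
  gap_isLittleO : ∀ ℓ, (fun n => γ n ℓ) =o[atTop] (fun n => c n ℓ)
  mixing : ∀ n (A B : Set (Fin d → ℤ)), A ⊆ K n → B ⊆ K n → IsSeparated (γ n) A B →
    (IsBox A ∨ IsBox B) →
    |probMaxLE P ξ (A ∪ B) (x n) - probMaxLE P ξ A (x n) * probMaxLE P ξ B (x n)| ≤ α n
  rate_tendsto : Tendsto α atTop (𝓝 0)

/-- `prec` is the strict part of a translation invariant total order on `ℤ^d`. -/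
structure IsTranslationInvariantOrder {d : ℕ} (prec : (Fin d → ℤ) → (Fin d → ℤ) → Prop) :
    Prop where
  strictTotal : IsStrictTotalOrder (Fin d → ℤ) prec
  translate : ∀ u v w, prec u v → prec (u + w) (v + w)

/-- The set `A_v = {z ∈ v + t [-1,1]^d ∩ ℤ^d : v ≺ z}`, with `t` the vector of side lengths. -/
def laterNeighbours {d : ℕ} (prec : (Fin d → ℤ) → (Fin d → ℤ) → Prop) (c : Fin d → ℝ) (k : ℕ)
    (v : Fin d → ℤ) : Set (Fin d → ℤ) :=
  {z | (∀ ℓ, |z ℓ - v ℓ| ≤ boxSide c k ℓ) ∧ prec v z}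

/-- The local condition `𝒟^ℓ(x_n; k_n; θ)`: `ℙ(M_ξ(A_0) ≤ x_n | ξ_0 > x_n) → θ`. The first field
says that the conditional probabilities are (eventually) well defined. -/
structure LocalCondition {d : ℕ} {Ω : Type*} [MeasurableSpace Ω] (P : Measure Ω)
    (ξ : (Fin d → ℤ) → Ω → ℝ) (prec : (Fin d → ℤ) → (Fin d → ℤ) → Prop)
    (c : ℕ → Fin d → ℝ) (x : ℕ → ℝ) (k : ℕ → ℕ) (θ : ℝ) : Prop where
  pos : ∀ᶠ n in atTop, 0 < P.real {ω | x n < ξ 0 ω}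
  tendsto : Tendsto
    (fun n => probMaxLE (ProbabilityTheory.cond P {ω | x n < ξ 0 ω}) ξ
      (laterNeighbours prec (c n) (k n) 0) (x n)) atTop (𝓝 θ)

end SpatialExtremes

end

/-!
The index set is tiled by cells, boxes `J` with sides `t = ⌊c / k^{1/d}⌋`; write `T = |J|`,
`q = P(ξ_0 > x)`, and let `θ_n` be the conditional probability of the local condition.

*Geometry.* About `k` cells meet `C` and about `k` cells lie inside `C`, so that `|D| ~ k T`. Only
the cells on the boundary of a convex body need an argument (`card_boundary_cells_le`): if a cell
sticks out of a closed convex set, a separating hyperplane provides a sign vector `s` such that no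
cell further along the diagonal direction `s` meets the set. Hence each of the `2^d` families of
parallel diagonals carries at most one such cell per line, which makes `O(k^{(d-1)/d})` cells.

*One cell.* Decompose the event that a set `A` has an exceedance according to the last one in the
order `≺`. For `A` of diameter at most `t`, the event "`ξ_v > x` and no exceedance follows within
distance `t`" can happen for one `v ∈ A` only, which gives `P(M(A) > x) ≥ |A| q θ_n`
(`IsStationary.card_mul_le_one_sub_probMaxLE`). For `A = J` equality fails only when there are
exceedances both in `J` and in the block `3J` outside of `J`; after shrinking `J` by the gap `γ`,
mixing bounds this probability by `O((T q)^2) + α` and a margin term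
(`IsStationary.one_sub_probMaxLE_cellPoints_le`).

*All cells.* Mixing makes the shrunk cells nearly independent
(`IsStationary.abs_probMaxLE_biUnion_cellCore_sub_le`). With the inner cells this gives
`P(M(D) ≤ x) ≤ exp(-θ |D| q (1 + o(1))) + o(1)`, without any assumption on `|D| q`. So `|D| q`
stays bounded if `P(M(D) ≤ x)` has a positive limit, and it trivially does so if it converges. Once
`|D| q` is bounded, all error terms of the lower bound from the outer cells vanish, and
`P(M(D) ≤ x) - exp(-θ |D| q) → 0`, from which both implications follow
(`tendsto_iff_of_block_bounds`).
-/

namespace SpatialExtremes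

/-! ### Cells of a grid -/

/-- The half-open cell `∏ [z_ℓ t_ℓ, (z_ℓ + 1) t_ℓ)` of the grid with side lengths `t`; for
`t = boxSide c k` it is `gridBox c k z` by definition. -/
def cell {d : ℕ} (t z : Fin d → ℤ) : Set (Fin d → ℝ) :=
  {u | ∀ ℓ, (z ℓ : ℝ) * t ℓ ≤ u ℓ ∧ u ℓ < ((z ℓ : ℝ) + 1) * t ℓ}

/-- The lattice points of `cell t z`. -/
noncomputable def cellPoints {d : ℕ} (t z : Fin d → ℤ) : Finset (Fin d → ℤ) :=
  Finset.Icc (fun ℓ => z ℓ * t ℓ) (fun ℓ => (z ℓ + 1) * t ℓ - 1)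

/-- The lattice points of `cell t z`, with a margin of width `g` removed at every face. -/
noncomputable def cellCore {d : ℕ} (t g z : Fin d → ℤ) : Finset (Fin d → ℤ) :=
  Finset.Icc (fun ℓ => z ℓ * t ℓ + g ℓ) (fun ℓ => (z ℓ + 1) * t ℓ - 1 - g ℓ)

/-- The indices of the cells that meet `C`. -/
def outerCells {d : ℕ} (t : Fin d → ℤ) (C : Set (Fin d → ℝ)) : Set (Fin d → ℤ) :=
  {z | (cell t z ∩ C).Nonempty}

/-- The indices of the cells contained in `C`. -/
def innerCells {d : ℕ} (t : Fin d → ℤ) (C : Set (Fin d → ℝ)) : Set (Fin d → ℤ) :=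
  {z | cell t z ⊆ C}

section Cells

variable {d : ℕ} {t : Fin d → ℤ}

theorem mem_cellPoints {z v : Fin d → ℤ} :
    v ∈ cellPoints t z ↔ ∀ ℓ, z ℓ * t ℓ ≤ v ℓ ∧ v ℓ < (z ℓ + 1) * t ℓ := by
  simp only [cellPoints, Finset.mem_Icc, Pi.le_def, ← forall_and, Int.le_sub_one_iff]

theorem mem_cellCore {g z v : Fin d → ℤ} :
    v ∈ cellCore t g z ↔ ∀ ℓ, z ℓ * t ℓ + g ℓ ≤ v ℓ ∧ v ℓ + g ℓ < (z ℓ + 1) * t ℓ := by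
  simp only [cellCore, Finset.mem_Icc, Pi.le_def, ← forall_and]
  refine forall_congr' fun ℓ => and_congr_right fun _ => ?_
  constructor <;> intro h <;> linarith

theorem toReal_mem_cell {z v : Fin d → ℤ} : toReal v ∈ cell t z ↔ v ∈ cellPoints t z := by
  rw [mem_cellPoints]
  refine forall_congr' fun ℓ => ?_
  simp only [toReal]
  norm_cast

theorem cellCore_subset {g z : Fin d → ℤ} (hg : ∀ ℓ, 0 ≤ g ℓ) :
    cellCore t g z ⊆ cellPoints t z := by
  intro v hv
  rw [mem_cellCore] at hv
  rw [mem_cellPoints]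
  intro ℓ
  have := hv ℓ
  have := hg ℓ
  constructor <;> linarith

theorem card_cellCore {g z : Fin d → ℤ} (hg : ∀ ℓ, 2 * g ℓ ≤ t ℓ) :
    ((cellCore t g z).card : ℝ) = ∏ ℓ, ((t ℓ : ℝ) - 2 * g ℓ) := by
  rw [cellCore, Pi.card_Icc, Nat.cast_prod]
  refine Finset.prod_congr rfl fun ℓ _ => ?_
  rw [Int.card_Icc]
  have h : (z ℓ + 1) * t ℓ - 1 - g ℓ + 1 - (z ℓ * t ℓ + g ℓ) = t ℓ - 2 * g ℓ := by ring
  rw [h, ← Int.cast_natCast, Int.toNat_of_nonneg (by linarith [hg ℓ])]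
  push_cast
  ring

theorem card_cellPoints {z : Fin d → ℤ} (ht : ∀ ℓ, 0 < t ℓ) :
    ((cellPoints t z).card : ℝ) = ∏ ℓ, (t ℓ : ℝ) := by
  have h : cellPoints t z = cellCore t 0 z := by
    ext v
    simp [mem_cellPoints, mem_cellCore]
  rw [h, card_cellCore (by simpa using fun ℓ => (ht ℓ).le)]
  simp

theorem cell_eq_pi (z : Fin d → ℤ) :
    cell t z = Set.pi univ fun ℓ => Ico ((z ℓ : ℝ) * t ℓ) (((z ℓ : ℝ) + 1) * t ℓ) := by
  ext u
  simp [cell]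

theorem measurableSet_cell (z : Fin d → ℤ) : MeasurableSet (cell t z) := by
  rw [cell_eq_pi]
  exact MeasurableSet.univ_pi fun _ => measurableSet_Ico

theorem volume_cell (z : Fin d → ℤ) (ht : ∀ ℓ, 0 < t ℓ) :
    (volume (cell t z)).toReal = ∏ ℓ, (t ℓ : ℝ) := by
  rw [cell_eq_pi, Real.volume_pi_Ico_toReal]
  · exact Finset.prod_congr rfl fun ℓ _ => by ring
  · intro ℓ
    have : (0 : ℝ) < t ℓ := by exact_mod_cast ht ℓ
    dsimp only
    nlinarith

theorem volume_cell_ne_top (z : Fin d → ℤ) : volume (cell t z) ≠ ⊤ := by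
  rw [cell_eq_pi, Real.volume_pi_Ico]
  exact ENNReal.prod_ne_top fun _ _ => ENNReal.ofReal_ne_top

theorem cell_nonempty (ht : ∀ ℓ, 0 < t ℓ) (z : Fin d → ℤ) : (cell t z).Nonempty := by
  refine ⟨fun ℓ => (z ℓ : ℝ) * t ℓ, fun ℓ => ⟨le_rfl, ?_⟩⟩
  have : (0 : ℝ) < t ℓ := by exact_mod_cast ht ℓ
  dsimp only
  nlinarith

theorem mem_cell_iff (ht : ∀ ℓ, 0 < t ℓ) {z : Fin d → ℤ} {u : Fin d → ℝ} :
    u ∈ cell t z ↔ z = fun ℓ => ⌊u ℓ / t ℓ⌋ := by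
  simp only [cell, mem_ofPred_eq, funext_iff]
  refine forall_congr' fun ℓ => ?_
  have : (0 : ℝ) < t ℓ := by exact_mod_cast ht ℓ
  rw [eq_comm, Int.floor_eq_iff, le_div_iff₀ this, div_lt_iff₀ this]

theorem pairwise_disjoint_cell (ht : ∀ ℓ, 0 < t ℓ) : Pairwise fun z w => Disjoint (cell t z) (cell t w) := by
  intro z w hzw
  rw [Set.disjoint_left]
  intro u hz hw
  rw [mem_cell_iff ht] at hz hw
  exact hzw (hz.trans hw.symm)

theorem pairwise_disjoint_cellPoints (ht : ∀ ℓ, 0 < t ℓ) :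
    Pairwise fun z w => Disjoint (cellPoints t z) (cellPoints t w) := by
  intro z w hzw
  rw [Finset.disjoint_left]
  intro v hz hw
  rw [← toReal_mem_cell] at hz hw
  exact Set.disjoint_left.1 (pairwise_disjoint_cell ht hzw) hz hw

theorem innerCells_subset_outerCells (ht : ∀ ℓ, 0 < t ℓ) (C : Set (Fin d → ℝ)) :
    innerCells t C ⊆ outerCells t C := by
  intro z hz
  obtain ⟨u, hu⟩ := cell_nonempty ht z
  exact ⟨u, hu, hz hu⟩

theorem subset_iUnion_outerCells (ht : ∀ ℓ, 0 < t ℓ) (C : Set (Fin d → ℝ)) :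
    C ⊆ ⋃ z ∈ outerCells t C, cell t z := by
  intro u hu
  have h := (mem_cell_iff ht (u := u)).2 rfl
  exact mem_biUnion (show _ ∈ outerCells t C from ⟨u, h, hu⟩) h

theorem outerCells_subset (ht : ∀ ℓ, 0 < t ℓ) {C : Set (Fin d → ℝ)} {r : Fin d → ℝ} {M : ℕ}
    (hC : ∀ u ∈ C, ∀ ℓ, |u ℓ| ≤ r ℓ) (hM : ∀ ℓ, r ℓ / t ℓ + 1 ≤ M) :
    outerCells t C ⊆ Set.Icc (fun _ => -(M : ℤ)) (fun _ => (M : ℤ)) := by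
  rintro z ⟨u, hz, hu⟩
  have key : ∀ ℓ, -(M : ℤ) ≤ z ℓ ∧ z ℓ ≤ M := by
    intro ℓ
    have h0 : (0 : ℝ) < t ℓ := by exact_mod_cast ht ℓ
    obtain ⟨h1, h2⟩ := hz ℓ
    have h3 := abs_le.1 (hC u hu ℓ)
    have h4 := hM ℓ
    have h5 : r ℓ ≤ ((M : ℝ) - 1) * t ℓ := by
      rw [← div_le_iff₀ h0]
      linarith
    have h6 : (z ℓ : ℝ) ≤ M := by
      have : (z ℓ : ℝ) * t ℓ ≤ ((M : ℝ) - 1) * t ℓ := by linarith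
      linarith [le_of_mul_le_mul_right this h0]
    have h7 : -(M : ℝ) ≤ z ℓ := by
      have : (-((M : ℝ) - 1)) * t ℓ < ((z ℓ : ℝ) + 1) * t ℓ := by linarith
      linarith [lt_of_mul_lt_mul_right this h0.le]
    exact ⟨by exact_mod_cast h7, by exact_mod_cast h6⟩
  exact ⟨fun ℓ => (key ℓ).1, fun ℓ => (key ℓ).2⟩

/-- If the cell `z` sticks out of the closed convex set `K`, a hyperplane separates a point of the
cell from `K`. With the signs `s` of its normal vector, every cell strictly further along the
diagonal `z + ℤ s` lies entirely on the far side. -/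
theorem exists_diagonal_leaving_convex {K : Set (Fin d → ℝ)} (hK : Convex ℝ K)
    (hKc : IsClosed K) {z : Fin d → ℤ} (ht : ∀ ℓ, 0 < t ℓ) (hz : ¬ cell t z ⊆ K) :
    ∃ s : Fin d → ℤˣ, ∀ j : ℤ, 0 < j → ∀ w : Fin d → ℤ, (∀ ℓ, w ℓ = z ℓ + j * s ℓ) →
      ¬ (cell t w ∩ K).Nonempty := by
  obtain ⟨y, hy, hyK⟩ := Set.not_subset.1 hz
  obtain ⟨f, u, hfK, hfy⟩ := geometric_hahn_banach_closed_point hK hKc hyK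
  refine ⟨fun ℓ => if 0 ≤ f (Pi.single ℓ 1) then 1 else -1, ?_⟩
  rintro j hj w hw ⟨y', hy', hy'K⟩
  have h1 : f y' < f y := (hfK y' hy'K).trans hfy
  have h2 : 0 ≤ f (y' - y) := by
    have hsum : f (y' - y) = ∑ ℓ, (y' - y) ℓ * f (Pi.single ℓ 1) := by
      have h := LinearMap.pi_apply_eq_sum_univ (f : (Fin d → ℝ) →ₗ[ℝ] ℝ) (y' - y)
      simp only [ContinuousLinearMap.coe_coe, smul_eq_mul] at h
      rw [h]
      refine Finset.sum_congr rfl fun ℓ _ => ?_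
      congr 2
      ext i
      simp [Pi.single_apply, eq_comm]
    rw [hsum]
    refine Finset.sum_nonneg fun ℓ _ => ?_
    have h0 : (0 : ℝ) < t ℓ := by exact_mod_cast ht ℓ
    have hj' : (1 : ℝ) ≤ j := by exact_mod_cast hj
    obtain ⟨a1, a2⟩ := hy ℓ
    obtain ⟨b1, b2⟩ := hy' ℓ
    rw [hw ℓ] at b1 b2
    rw [Pi.sub_apply]
    dsimp only at b1 b2
    split_ifs at b1 b2 with hs
    · refine mul_nonneg ?_ hs
      push_cast at b1
      nlinarith
    · refine mul_nonneg_of_nonpos_of_nonpos ?_ (not_le.1 hs).le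
      push_cast at b2
      nlinarith
  rw [map_sub] at h2
  linarith

/-- A convex set has few boundary cells: for each of the `2 ^ d` sign vectors `s`, a diagonal line
in direction `s` contains at most one cell that meets `K` and sticks out of it on the side `s`. -/
theorem card_boundary_cells_le (ℓ₀ : Fin d) (ht : ∀ ℓ, 0 < t ℓ) {K : Set (Fin d → ℝ)}
    (hK : Convex ℝ K) (hKc : IsClosed K) {M : ℕ} (S : Finset (Fin d → ℤ))
    (hM : ∀ z ∈ S, ∀ ℓ, |z ℓ| ≤ M) (hmeet : ∀ z ∈ S, (cell t z ∩ K).Nonempty)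
    (hnot : ∀ z ∈ S, ¬ cell t z ⊆ K) :
    S.card ≤ 2 ^ d * (4 * M + 1) ^ (d - 1) := by
  classical
  choose! s hs using fun z (hz : z ∈ S) => exists_diagonal_leaving_convex hK hKc ht (hnot z hz)
  -- The second component labels the diagonal `z + ℤ (s z)`; it vanishes at `ℓ₀`.
  let φ : (Fin d → ℤ) → (Fin d → ℤˣ) × (Fin d → ℤ) :=
    fun z => (s z, fun ℓ => z ℓ - s z ℓ * s z ℓ₀ * z ℓ₀)
  let R : Finset ((Fin d → ℤˣ) × (Fin d → ℤ)) := Finset.univ ×ˢ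
    Fintype.piFinset fun ℓ => if ℓ = ℓ₀ then {0} else Finset.Icc (-(2 * M : ℤ)) (2 * M)
  have hmaps : ∀ z ∈ S, φ z ∈ R := by
    intro z hz
    simp only [φ, R, Finset.mem_product, Finset.mem_univ, true_and, Fintype.mem_piFinset]
    intro ℓ
    split_ifs with h
    · subst h
      rw [← Units.val_mul, Int.units_mul_self]
      simp
    · rw [Finset.mem_Icc]
      have h1 := abs_le.1 (hM z hz ℓ)
      have h2 := abs_le.1 (hM z hz ℓ₀)
      rw [← Units.val_mul]
      rcases Int.units_eq_one_or (s z ℓ * s z ℓ₀) with h | h <;> rw [h] <;> push_cast <;>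
        constructor <;> linarith
  have hinj : Set.InjOn φ S := by
    have key : ∀ z ∈ S, ∀ w ∈ S, φ z = φ w → ¬ 0 < (s z ℓ₀ : ℤ) * (w ℓ₀ - z ℓ₀) := by
      intro z hz w hw h hpos
      simp only [φ, Prod.mk.injEq] at h
      obtain ⟨h1, h2⟩ := h
      refine hs z hz _ hpos w (fun ℓ => ?_) (hmeet w hw)
      have h3 := congrFun h2 ℓ
      rw [← h1] at h3
      linear_combination -h3
    intro z hz w hw h
    have k1 := key z hz w hw h
    have k2 := key w hw z hz h.symm
    simp only [φ, Prod.mk.injEq] at h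
    obtain ⟨h1, h2⟩ := h
    rw [← h1] at k2
    have h0 : (s z ℓ₀ : ℤ) * (w ℓ₀ - z ℓ₀) = 0 := by linarith
    have h0' : w ℓ₀ = z ℓ₀ := by
      rcases mul_eq_zero.1 h0 with h | h
      · exact absurd h (Units.ne_zero _)
      · linarith
    ext ℓ
    have h3 := congrFun h2 ℓ
    rw [← h1, h0'] at h3
    linarith
  refine (Finset.card_le_card_of_injOn φ hmaps hinj).trans (le_of_eq ?_)
  simp only [R, Finset.card_product, Finset.card_univ, Fintype.card_pi, Finset.prod_const,
    Fintype.card_fin, Fintype.card_piFinset, Fintype.card_units_int]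
  congr 1
  rw [← Finset.mul_prod_erase _ _ (Finset.mem_univ ℓ₀), if_pos rfl, Finset.card_singleton, one_mul]
  rw [Finset.prod_congr rfl (g := fun _ => 4 * M + 1), Finset.prod_const,
    Finset.card_erase_of_mem (Finset.mem_univ _), Finset.card_univ, Fintype.card_fin]
  intro ℓ hℓ
  rw [if_neg (Finset.ne_of_mem_erase hℓ), Int.card_Icc]
  omega

theorem ncard_outerCells_le {p : ℕ} (ℓ₀ : Fin d) (ht : ∀ ℓ, 0 < t ℓ) {C : Set (Fin d → ℝ)}
    (hC : IsPConvex p C) {M : ℕ}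
    (hM : outerCells t C ⊆ Set.Icc (fun _ => -(M : ℤ)) (fun _ => (M : ℤ))) :
    (outerCells t C).ncard ≤
      (innerCells t C).ncard + p * (2 ^ d * (4 * M + 1) ^ (d - 1)) := by
  classical
  obtain ⟨B, hB, rfl⟩ := hC
  set C := ⋃ i, B i with hCdef
  have hfin : (outerCells t C).Finite := (Set.finite_Icc _ _).subset hM
  have hsub := innerCells_subset_outerCells ht C
  -- A cell that meets `C` without being contained in it is a boundary cell of some `B i`.
  have hcov : outerCells t C ⊆ innerCells t C ∪
      ((Finset.univ.biUnion fun i => hfin.toFinset.filter fun z =>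
        (cell t z ∩ B i).Nonempty ∧ ¬ cell t z ⊆ B i : Finset (Fin d → ℤ)) : Set _) := by
    intro z hz
    by_cases h : z ∈ innerCells t C
    · exact Or.inl h
    · right
      obtain ⟨u, hu, huC⟩ := id hz
      obtain ⟨i, hi⟩ := mem_iUnion.1 huC
      simp only [Finset.coe_biUnion, Finset.mem_coe, mem_iUnion, Finset.mem_univ,
        Finset.mem_filter, Set.Finite.mem_toFinset]
      exact ⟨i, trivial, hz, ⟨u, hu, hi⟩, fun h' => h (h'.trans (subset_iUnion B i))⟩
  refine (Set.ncard_le_ncard hcov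
    ((hfin.subset hsub).union (Finset.finite_toSet _))).trans ?_
  refine (Set.ncard_union_le _ _).trans (Nat.add_le_add_left ?_ _)
  rw [Set.ncard_coe_finset]
  refine Finset.card_biUnion_le.trans ?_
  refine (Finset.sum_le_card_nsmul _ _ (2 ^ d * (4 * M + 1) ^ (d - 1)) ?_).trans
    (by simp)
  intro i _
  refine card_boundary_cells_le ℓ₀ ht (hB i).1 (hB i).2.1.isClosed _ ?_ ?_ ?_
  · intro z hz ℓ
    have := hM (hfin.mem_toFinset.1 (Finset.mem_filter.1 hz).1)
    exact abs_le.2 ⟨this.1 ℓ, this.2 ℓ⟩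
  · exact fun z hz => (Finset.mem_filter.1 hz).2.1
  · exact fun z hz => (Finset.mem_filter.1 hz).2.2

theorem ncard_innerCells_mul_le_volume (ht : ∀ ℓ, 0 < t ℓ) {C : Set (Fin d → ℝ)}
    (hfin : (innerCells t C).Finite) (hC : volume C ≠ ⊤) :
    ((innerCells t C).ncard : ℝ) * ∏ ℓ, (t ℓ : ℝ) ≤ (volume C).toReal := by
  have h : volume (⋃ z ∈ hfin.toFinset, cell t z) ≤ volume C :=
    measure_mono (iUnion₂_subset fun z hz => hfin.mem_toFinset.1 hz)
  rw [measure_biUnion_finset ((pairwise_disjoint_cell ht).set_pairwise _)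
    fun z _ => measurableSet_cell z] at h
  have h' := ENNReal.toReal_mono hC h
  rw [ENNReal.toReal_sum fun z _ => volume_cell_ne_top z,
    Finset.sum_congr rfl fun z _ => volume_cell z ht, Finset.sum_const, nsmul_eq_mul,
    ← Set.ncard_eq_toFinset_card _ hfin] at h'
  exact h'

theorem volume_le_ncard_outerCells_mul (ht : ∀ ℓ, 0 < t ℓ) {C : Set (Fin d → ℝ)}
    (hfin : (outerCells t C).Finite) :
    (volume C).toReal ≤ ((outerCells t C).ncard : ℝ) * ∏ ℓ, (t ℓ : ℝ) := by
  have h : volume C ≤ ∑ z ∈ hfin.toFinset, volume (cell t z) := by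
    refine (measure_mono ?_).trans (measure_biUnion_finset_le _ _)
    simpa using subset_iUnion_outerCells ht C
  have h' := ENNReal.toReal_mono (ENNReal.sum_ne_top.2 fun z _ => volume_cell_ne_top z) h
  rw [ENNReal.toReal_sum fun z _ => volume_cell_ne_top z,
    Finset.sum_congr rfl fun z _ => volume_cell z ht, Finset.sum_const, nsmul_eq_mul,
    ← Set.ncard_eq_toFinset_card _ hfin] at h'
  exact h'

theorem latticePoints_subset_biUnion (ht : ∀ ℓ, 0 < t ℓ) {C : Set (Fin d → ℝ)}
    (hfin : (outerCells t C).Finite) :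
    latticePoints C ⊆ (hfin.toFinset.biUnion (cellPoints t) : Finset (Fin d → ℤ)) := by
  intro v hv
  obtain ⟨z, hz, hvz⟩ := mem_iUnion₂.1 (subset_iUnion_outerCells ht C hv)
  rw [Finset.coe_biUnion]
  exact mem_biUnion (hfin.mem_toFinset.2 hz) (toReal_mem_cell.1 hvz)

theorem biUnion_subset_latticePoints {C : Set (Fin d → ℝ)} (hfin : (innerCells t C).Finite) :
    ((hfin.toFinset.biUnion (cellPoints t) : Finset (Fin d → ℤ)) : Set (Fin d → ℤ)) ⊆
      latticePoints C := by
  rw [Finset.coe_biUnion]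
  refine iUnion₂_subset fun z hz v hv => ?_
  exact hfin.mem_toFinset.1 hz (toReal_mem_cell.2 hv)

theorem card_biUnion_cellPoints (ht : ∀ ℓ, 0 < t ℓ) (S : Finset (Fin d → ℤ)) :
    ((S.biUnion (cellPoints t)).card : ℝ) = S.card * ∏ ℓ, (t ℓ : ℝ) := by
  rw [Finset.card_biUnion fun z _ w _ h => pairwise_disjoint_cellPoints ht h, Nat.cast_sum,
    Finset.sum_congr rfl fun z _ => card_cellPoints ht, Finset.sum_const, nsmul_eq_mul]

theorem ncard_latticePoints_le (ht : ∀ ℓ, 0 < t ℓ) {C : Set (Fin d → ℝ)}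
    (hfin : (outerCells t C).Finite) :
    ((latticePoints C).ncard : ℝ) ≤ ((outerCells t C).ncard : ℝ) * ∏ ℓ, (t ℓ : ℝ) := by
  rw [Set.ncard_eq_toFinset_card _ hfin, ← card_biUnion_cellPoints ht, ← Set.ncard_coe_finset]
  exact_mod_cast Set.ncard_le_ncard (latticePoints_subset_biUnion ht hfin) (Finset.finite_toSet _)

theorem le_ncard_latticePoints (ht : ∀ ℓ, 0 < t ℓ) {C : Set (Fin d → ℝ)}
    (hfin : (outerCells t C).Finite) :
    ((innerCells t C).ncard : ℝ) * ∏ ℓ, (t ℓ : ℝ) ≤ ((latticePoints C).ncard : ℝ) := by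
  have hfin' := hfin.subset (innerCells_subset_outerCells ht C)
  rw [Set.ncard_eq_toFinset_card _ hfin', ← card_biUnion_cellPoints ht, ← Set.ncard_coe_finset]
  exact_mod_cast Set.ncard_le_ncard (biUnion_subset_latticePoints hfin')
    ((Finset.finite_toSet _).subset (latticePoints_subset_biUnion ht hfin))

end Cells

/-! ### Events of the field -/

section Field

variable {d : ℕ} {Ω : Type*}

theorem fieldMax_le_iff {ξ : (Fin d → ℤ) → Ω → ℝ} {A : Set (Fin d → ℤ)} {x : ℝ} {ω : Ω} :
    fieldMax ξ A ω ≤ (x : EReal) ↔ ∀ v ∈ A, ξ v ω ≤ x := by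
  simp [fieldMax, iSup_le_iff]

variable [MeasurableSpace Ω] {P : Measure Ω} {ξ : (Fin d → ℤ) → Ω → ℝ}

theorem probMaxLE_eq (A : Set (Fin d → ℤ)) (x : ℝ) :
    probMaxLE P ξ A x = P.real {ω | ∀ v ∈ A, ξ v ω ≤ x} := by
  simp only [probMaxLE, fieldMax_le_iff]

theorem measurableSet_forall_le (hξ : ∀ v, Measurable (ξ v)) (A : Set (Fin d → ℤ)) (x : ℝ) :
    MeasurableSet {ω | ∀ v ∈ A, ξ v ω ≤ x} := by
  have h : {ω | ∀ v ∈ A, ξ v ω ≤ x} = ⋂ v ∈ A, {ω | ξ v ω ≤ x} := by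
    ext ω
    simp
  rw [h]
  exact MeasurableSet.biInter A.to_countable fun v _ => measurableSet_le (hξ v) measurable_const

theorem measurableSet_exists_lt (hξ : ∀ v, Measurable (ξ v)) (A : Set (Fin d → ℤ)) (x : ℝ) :
    MeasurableSet {ω | ∃ v ∈ A, x < ξ v ω} := by
  have h : {ω | ∃ v ∈ A, x < ξ v ω} = {ω | ∀ v ∈ A, ξ v ω ≤ x}ᶜ := by
    ext ω
    simp
  rw [h]
  exact (measurableSet_forall_le hξ A x).compl

theorem real_exists_lt [IsProbabilityMeasure P] (hξ : ∀ v, Measurable (ξ v))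
    (A : Set (Fin d → ℤ)) (x : ℝ) :
    P.real {ω | ∃ v ∈ A, x < ξ v ω} = 1 - probMaxLE P ξ A x := by
  rw [probMaxLE_eq, ← probReal_compl_eq_one_sub (measurableSet_forall_le hξ A x)]
  congr 1
  ext ω
  simp

theorem probMaxLE_anti [IsProbabilityMeasure P] {A B : Set (Fin d → ℤ)} (h : A ⊆ B) (x : ℝ) :
    probMaxLE P ξ B x ≤ probMaxLE P ξ A x := by
  rw [probMaxLE_eq, probMaxLE_eq]
  exact measureReal_mono fun ω hω v hv => hω v (h hv)

theorem probMaxLE_nonneg (A : Set (Fin d → ℤ)) (x : ℝ) : 0 ≤ probMaxLE P ξ A x :=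
  measureReal_nonneg

theorem probMaxLE_le_one [IsProbabilityMeasure P] (A : Set (Fin d → ℤ)) (x : ℝ) :
    probMaxLE P ξ A x ≤ 1 :=
  measureReal_le_one

/-! ### Stationarity -/

theorem IsStationary.real_shift (hstat : IsStationary P ξ) (hξ : ∀ v, Measurable (ξ v))
    {S : Set ((Fin d → ℤ) → ℝ)} (hS : MeasurableSet S) (w : Fin d → ℤ) :
    P.real {ω | (fun v => ξ (v + w) ω) ∈ S} = P.real {ω | (fun v => ξ v ω) ∈ S} := by
  have h := congrArg (fun μ => μ.real S) (hstat w)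
  rw [map_measureReal_apply (measurable_pi_lambda _ fun v => hξ _) hS,
    map_measureReal_apply (measurable_pi_lambda _ fun v => hξ _) hS] at h
  exact h

theorem IsStationary.probMaxLE_eq_of_shift (hstat : IsStationary P ξ)
    (hξ : ∀ v, Measurable (ξ v)) {A B : Set (Fin d → ℤ)} (w : Fin d → ℤ)
    (h : ∀ v, v ∈ A ↔ v + w ∈ B) (x : ℝ) : probMaxLE P ξ B x = probMaxLE P ξ A x := by
  have h1 := hstat.real_shift hξ (measurableSet_forall_le (ξ := fun v f => f v)
    (fun v => measurable_pi_apply v) A x) w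
  rw [probMaxLE_eq, probMaxLE_eq]
  refine Eq.trans (congrArg _ (Set.ext fun ω => ?_)) h1
  simp only [mem_ofPred_eq]
  constructor
  · exact fun hω v hv => hω _ ((h v).1 hv)
  · intro hω v hv
    have := hω (v - w) ((h _).2 (by simpa using hv))
    simpa using this

theorem IsStationary.real_lt (hstat : IsStationary P ξ) (hξ : ∀ v, Measurable (ξ v)) (x : ℝ)
    (v : Fin d → ℤ) : P.real {ω | x < ξ v ω} = P.real {ω | x < ξ 0 ω} := by
  have h := hstat.real_shift hξ (S := {f | x < f 0})
    (measurableSet_lt measurable_const (measurable_pi_apply 0)) v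
  simpa using h

/-- The union bound for the exceedances of the level `x`. -/
theorem IsStationary.one_sub_probMaxLE_le [IsProbabilityMeasure P] (hstat : IsStationary P ξ)
    (hξ : ∀ v, Measurable (ξ v)) (A : Finset (Fin d → ℤ)) (x : ℝ) :
    1 - probMaxLE P ξ A x ≤ A.card * P.real {ω | x < ξ 0 ω} := by
  rw [← real_exists_lt hξ]
  have h : {ω | ∃ v ∈ (A : Set (Fin d → ℤ)), x < ξ v ω} = ⋃ v ∈ A, {ω | x < ξ v ω} := by
    ext ω
    simp
  rw [h]
  refine (measureReal_biUnion_finset_le _ _).trans (le_of_eq ?_)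
  rw [Finset.sum_congr rfl fun v _ => hstat.real_lt hξ x v, Finset.sum_const, nsmul_eq_mul]

theorem IsStationary.probMaxLE_le_union [IsProbabilityMeasure P] (hstat : IsStationary P ξ)
    (hξ : ∀ v, Measurable (ξ v)) (A : Set (Fin d → ℤ)) (B : Finset (Fin d → ℤ)) (x : ℝ) :
    probMaxLE P ξ A x ≤ probMaxLE P ξ (A ∪ B) x + B.card * P.real {ω | x < ξ 0 ω} := by
  have h1 := hstat.one_sub_probMaxLE_le hξ B x
  rw [← real_exists_lt hξ] at h1
  refine le_trans ?_ (add_le_add_right h1 _)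
  rw [probMaxLE_eq, probMaxLE_eq]
  refine (measureReal_mono ?_).trans (measureReal_union_le _ _)
  intro ω hω
  by_cases h : ∃ v ∈ (B : Set (Fin d → ℤ)), x < ξ v ω
  · exact Or.inr h
  · push Not at h
    exact Or.inl fun v hv => hv.elim (hω v) (h v)

/-! ### The last exceedance of a block -/

/-- The event that `v` is an exceedance of the level `x` and has no later exceedance in its
neighbourhood `laterNeighbours prec c k v`. -/
def lastExceedance (ξ : (Fin d → ℤ) → Ω → ℝ) (prec : (Fin d → ℤ) → (Fin d → ℤ) → Prop)
    (c : Fin d → ℝ) (k : ℕ) (x : ℝ) (v : Fin d → ℤ) : Set Ω :=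
  {ω | x < ξ v ω ∧ ∀ z ∈ laterNeighbours prec c k v, ξ z ω ≤ x}

variable {prec : (Fin d → ℤ) → (Fin d → ℤ) → Prop} {c : Fin d → ℝ} {k : ℕ} {x : ℝ}

theorem measurableSet_lastExceedance (hξ : ∀ v, Measurable (ξ v)) (v : Fin d → ℤ) :
    MeasurableSet (lastExceedance ξ prec c k x v) :=
  (measurableSet_lt measurable_const (hξ v)).inter (measurableSet_forall_le hξ _ x)

theorem IsTranslationInvariantOrder.add_mem_laterNeighbours_iff
    (hprec : IsTranslationInvariantOrder prec) (z v : Fin d → ℤ) :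
    z + v ∈ laterNeighbours prec c k v ↔ z ∈ laterNeighbours prec c k 0 := by
  simp only [laterNeighbours, mem_ofPred_eq, Pi.add_apply, add_sub_cancel_right, Pi.zero_apply,
    sub_zero]
  refine and_congr_right fun _ => ⟨fun h => ?_, fun h => ?_⟩
  · simpa using hprec.translate _ _ (-v) h
  · simpa using hprec.translate _ _ v h

theorem IsStationary.real_lastExceedance (hstat : IsStationary P ξ) (hξ : ∀ v, Measurable (ξ v))
    (hprec : IsTranslationInvariantOrder prec) (v : Fin d → ℤ) :
    P.real (lastExceedance ξ prec c k x v) = P.real (lastExceedance ξ prec c k x 0) := by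
  have h := hstat.real_shift hξ (measurableSet_lastExceedance (ξ := fun v f => f v)
    (prec := prec) (c := c) (k := k) (x := x) (fun v => measurable_pi_apply v) 0) v
  refine Eq.trans (congrArg _ (Set.ext fun ω => ?_)) h
  simp only [lastExceedance, mem_ofPred_eq, zero_add]
  refine and_congr_right fun _ => ⟨fun hω z hz => ?_, fun hω z hz => ?_⟩
  · exact hω _ ((hprec.add_mem_laterNeighbours_iff z v).2 hz)
  · have := hω (z - v) ((hprec.add_mem_laterNeighbours_iff _ v).1 (by simpa using hz))
    simpa using this

theorem probMaxLE_cond_mul [IsProbabilityMeasure P] (hξ : ∀ v, Measurable (ξ v)) :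
    probMaxLE (ProbabilityTheory.cond P {ω | x < ξ 0 ω}) ξ (laterNeighbours prec c k 0) x *
      P.real {ω | x < ξ 0 ω} = P.real (lastExceedance ξ prec c k x 0) := by
  rw [probMaxLE_eq, measureReal_def, measureReal_def, ← ENNReal.toReal_mul,
    cond_mul_eq_inter (measurableSet_lt measurable_const (hξ 0))]
  rfl

/-- In a set `A` of diameter at most the side lengths, different sites cannot both carry their
last exceedance. -/
theorem IsStationary.card_mul_le_one_sub_probMaxLE [IsProbabilityMeasure P]
    (hstat : IsStationary P ξ) (hξ : ∀ v, Measurable (ξ v))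
    (hprec : IsTranslationInvariantOrder prec) (A : Finset (Fin d → ℤ))
    (hA : ∀ v ∈ A, ∀ z ∈ A, ∀ ℓ, |z ℓ - v ℓ| ≤ boxSide c k ℓ) :
    A.card * P.real (lastExceedance ξ prec c k x 0) ≤ 1 - probMaxLE P ξ A x := by
  rw [← real_exists_lt hξ]
  have hdisj : Set.PairwiseDisjoint (A : Set (Fin d → ℤ)) (lastExceedance ξ prec c k x) := by
    intro v hv w hw hvw
    rw [Function.onFun, Set.disjoint_left]
    intro ω hωv hωw
    have := hprec.strictTotal
    rcases trichotomous_of prec v w with h | h | h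
    · exact absurd (hωv.2 w ⟨hA v hv w hw, h⟩) (not_le.2 hωw.1)
    · exact hvw h
    · exact absurd (hωw.2 v ⟨hA w hw v hv, h⟩) (not_le.2 hωv.1)
  have h := measureReal_biUnion_finset (μ := P) hdisj
    fun v _ => measurableSet_lastExceedance hξ v
  rw [Finset.sum_congr rfl fun v _ => hstat.real_lastExceedance hξ hprec v, Finset.sum_const,
    nsmul_eq_mul] at h
  rw [← h]
  refine measureReal_mono (iUnion₂_subset fun v hv ω hω => ⟨v, hv, hω.1⟩)

/-- If the last exceedance of `A` is followed by another one in its neighbourhood, then the latter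
lies in `B`. -/
theorem IsStationary.one_sub_probMaxLE_le_card_mul_add [IsProbabilityMeasure P]
    (hstat : IsStationary P ξ) (hξ : ∀ v, Measurable (ξ v))
    (hprec : IsTranslationInvariantOrder prec) (A B : Finset (Fin d → ℤ))
    (hAB : ∀ v ∈ A, laterNeighbours prec c k v ⊆ A ∪ B) :
    1 - probMaxLE P ξ A x ≤ A.card * P.real (lastExceedance ξ prec c k x 0) +
      P.real ({ω | ∃ v ∈ A, x < ξ v ω} ∩ {ω | ∃ v ∈ B, x < ξ v ω}) := by
  rw [← real_exists_lt hξ]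
  have hcov : {ω | ∃ v ∈ (A : Set (Fin d → ℤ)), x < ξ v ω} ⊆
      (⋃ v ∈ A, lastExceedance ξ prec c k x v) ∪
        ({ω | ∃ v ∈ A, x < ξ v ω} ∩ {ω | ∃ v ∈ B, x < ξ v ω}) := by
    rintro ω ⟨u, hu, hxu⟩
    have := hprec.strictTotal
    have hfin : Set.Finite {v | v ∈ A ∧ x < ξ v ω} := A.finite_toSet.subset fun v hv => hv.1
    obtain ⟨v, hv, hmax⟩ : ∃ v, (v ∈ A ∧ x < ξ v ω) ∧ ∀ w, w ∈ A → x < ξ w ω → ¬ prec v w := by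
      have hw : Set.WellFoundedOn {v | v ∈ A ∧ x < ξ v ω} (fun v w => prec w v) := by
        have : IsStrictOrder (Fin d → ℤ) (fun v w => prec w v) :=
          { irrefl := fun a => irrefl_of prec a
            trans := fun a b c hab hbc => _root_.trans hbc hab }
        exact hfin.wellFoundedOn
      obtain ⟨v, hv, hm⟩ := hw.has_min (Set.univ : Set _) ⟨⟨u, hu, hxu⟩, trivial⟩
      exact ⟨v.1, v.2, fun w hwA hxw h => hm ⟨w, hwA, hxw⟩ trivial h⟩
    by_cases h : ∀ z ∈ laterNeighbours prec c k v, ξ z ω ≤ x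
    · exact Or.inl (mem_biUnion (x := v) hv.1 ⟨hv.2, h⟩)
    · push Not at h
      obtain ⟨z, hz, hxz⟩ := h
      refine Or.inr ⟨⟨u, hu, hxu⟩, z, ?_, hxz⟩
      rcases hAB v hv.1 hz with hzA | hzB
      · exact absurd hz.2 (hmax z hzA hxz)
      · exact hzB
  refine (measureReal_mono hcov).trans ((measureReal_union_le _ _).trans ?_)
  refine add_le_add_left ((measureReal_biUnion_finset_le _ _).trans (le_of_eq ?_)) _
  rw [Finset.sum_congr rfl fun v _ => hstat.real_lastExceedance hξ hprec v, Finset.sum_const,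
    nsmul_eq_mul]

end Field

/-! ### Mixing for shrunk cells -/

section Mixing

variable {d : ℕ} {t g : Fin d → ℤ} {γ : Fin d → ℝ}

theorem isSeparated_cellCore (hγ : ∀ ℓ, 0 < γ ℓ) (hg : ∀ ℓ, γ ℓ ≤ g ℓ) (z : Fin d → ℤ)
    {B : Set (Fin d → ℤ)} (hB : ∀ v ∈ B, v ∉ cellPoints t z) :
    IsSeparated γ (cellCore t g z : Set (Fin d → ℤ)) B := by
  rintro _ ⟨v, hv, rfl⟩ ⟨_, ⟨a, ha, rfl⟩, _, ⟨u, hu, rfl⟩, h⟩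
  refine hB v hv (mem_cellPoints.2 fun ℓ => ?_)
  have h1 : |u ℓ| ≤ 1 := by
    have := PiLp.norm_apply_le (WithLp.toLp 2 u : EuclideanSpace ℝ (Fin d)) ℓ
    exact this.trans hu
  have h2 : (a ℓ : ℝ) + γ ℓ * u ℓ = v ℓ := congrFun h ℓ
  have h3 := abs_le.1 h1
  have h4 := hγ ℓ
  have h5 := hg ℓ
  have h6 := (mem_cellCore.1 ha) ℓ
  have h7 : (v ℓ : ℝ) ≤ a ℓ + g ℓ := by nlinarith
  have h8 : (a ℓ : ℝ) ≤ v ℓ + g ℓ := by nlinarith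
  have h7' : v ℓ ≤ a ℓ + g ℓ := by exact_mod_cast h7
  have h8' : a ℓ ≤ v ℓ + g ℓ := by exact_mod_cast h8
  constructor <;> linarith

variable {Ω : Type*} [MeasurableSpace Ω] {P : Measure Ω}
  {ξ : (Fin d → ℤ) → Ω → ℝ} {x : ℝ} {K : Set (Fin d → ℤ)} {α : ℝ}

theorem IsStationary.probMaxLE_cellCore (hstat : IsStationary P ξ) (hξ : ∀ v, Measurable (ξ v))
    (z : Fin d → ℤ) : probMaxLE P ξ (cellCore t g z) x = probMaxLE P ξ (cellCore t g 0) x := by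
  refine hstat.probMaxLE_eq_of_shift hξ (fun ℓ => z ℓ * t ℓ) (fun v => ?_) x
  simp only [Finset.mem_coe, mem_cellCore, Pi.add_apply, Pi.zero_apply]
  refine forall_congr' fun ℓ => ?_
  constructor <;> rintro ⟨h1, h2⟩ <;> constructor <;> linarith

variable [IsProbabilityMeasure P]

/-- Mixing makes the shrunk cells independent, up to an error `α` for each cell. -/
theorem IsStationary.abs_probMaxLE_biUnion_cellCore_sub_le (hstat : IsStationary P ξ)
    (hξ : ∀ v, Measurable (ξ v))
    (hmix : ∀ A B : Set (Fin d → ℤ), A ⊆ K → B ⊆ K → IsSeparated γ A B → (IsBox A ∨ IsBox B) →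
      |probMaxLE P ξ (A ∪ B) x - probMaxLE P ξ A x * probMaxLE P ξ B x| ≤ α)
    (ht : ∀ ℓ, 0 < t ℓ) (hγ : ∀ ℓ, 0 < γ ℓ) (hg : ∀ ℓ, γ ℓ ≤ g ℓ)
    (S : Finset (Fin d → ℤ)) (hS : ∀ z ∈ S, (cellPoints t z : Set (Fin d → ℤ)) ⊆ K) :
    |probMaxLE P ξ (S.biUnion (cellCore t g) : Finset (Fin d → ℤ)) x -
      probMaxLE P ξ (cellCore t g 0) x ^ S.card| ≤ S.card * α := by
  classical
  have hg0 : ∀ ℓ, 0 ≤ g ℓ := fun ℓ => by exact_mod_cast ((hγ ℓ).trans_le (hg ℓ)).le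
  induction S using Finset.induction_on with
  | empty => simp [probMaxLE_eq]
  | insert z S hz ih =>
    have ih' := ih fun w hw => hS w (Finset.mem_insert_of_mem hw)
    set F := probMaxLE P ξ (S.biUnion (cellCore t g) : Finset (Fin d → ℤ)) x
    set p := probMaxLE P ξ (cellCore t g 0) x
    have hp0 : 0 ≤ p := probMaxLE_nonneg _ _
    have hp1 : p ≤ 1 := probMaxLE_le_one _ _
    have h := hmix (cellCore t g z) (S.biUnion (cellCore t g) : Finset (Fin d → ℤ)) ?_ ?_
      (isSeparated_cellCore hγ hg z ?_) (Or.inl ⟨_, _, Finset.coe_Icc _ _⟩)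
    · rw [hstat.probMaxLE_cellCore hξ z] at h
      rw [Finset.biUnion_insert, Finset.coe_union, Finset.card_insert_of_notMem hz, pow_succ]
      have h2 : |p * (F - p ^ S.card)| ≤ S.card * α := by
        rw [abs_mul, abs_of_nonneg hp0]
        exact (mul_le_of_le_one_left (abs_nonneg _) hp1).trans ih'
      have h3 := abs_add_le (probMaxLE P ξ (↑(cellCore t g z) ∪
        ((S.biUnion (cellCore t g) : Finset (Fin d → ℤ)) : Set (Fin d → ℤ))) x - p * F)
        (p * (F - p ^ S.card))
      rw [Nat.cast_add, Nat.cast_one]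
      calc _ = _ := by congr 1; ring
        _ ≤ _ := h3
        _ ≤ α + S.card * α := add_le_add h h2
        _ = _ := by ring
    · exact (Finset.coe_subset.2 (cellCore_subset hg0)).trans (hS z (Finset.mem_insert_self _ _))
    · rw [Finset.coe_biUnion]
      exact iUnion₂_subset fun w hw => (Finset.coe_subset.2 (cellCore_subset hg0)).trans
        (hS w (Finset.mem_insert_of_mem hw))
    · intro v hv hvz
      obtain ⟨w, hw, hvw⟩ := Finset.mem_biUnion.1 (Finset.mem_coe.1 hv)
      have hne : w ≠ z := fun h => hz (h ▸ hw)
      exact Finset.disjoint_left.1 (pairwise_disjoint_cellPoints ht hne)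
        (cellCore_subset hg0 hvw) hvz

/-- The mixing bound, stated for avoiding exceedances, in terms of their simultaneous occurrence. -/
theorem real_exceedances_inter_le (hξ : ∀ v, Measurable (ξ v)) {A B : Set (Fin d → ℤ)}
    (h : |probMaxLE P ξ (A ∪ B) x - probMaxLE P ξ A x * probMaxLE P ξ B x| ≤ α) :
    P.real ({ω | ∃ v ∈ A, x < ξ v ω} ∩ {ω | ∃ v ∈ B, x < ξ v ω}) ≤
      (1 - probMaxLE P ξ A x) * (1 - probMaxLE P ξ B x) + α := by
  have h1 := measureReal_union_add_inter (μ := P) (s := {ω | ∃ v ∈ A, x < ξ v ω})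
    (measurableSet_exists_lt hξ B x)
  have h2 : {ω | ∃ v ∈ A, x < ξ v ω} ∪ {ω | ∃ v ∈ B, x < ξ v ω} =
      {ω | ∃ v ∈ A ∪ B, x < ξ v ω} := by
    ext ω
    simp [or_and_right, exists_or]
  rw [h2, real_exists_lt hξ, real_exists_lt hξ, real_exists_lt hξ] at h1
  have h3 := (abs_le.1 h).2
  nlinarith

/-- The block estimate from above. The error terms account for the margin of the cell and for a
cluster of exceedances that leaves the cell. -/
theorem IsStationary.one_sub_probMaxLE_cellPoints_le (hstat : IsStationary P ξ)
    (hξ : ∀ v, Measurable (ξ v)) {prec : (Fin d → ℤ) → (Fin d → ℤ) → Prop}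
    (hprec : IsTranslationInvariantOrder prec) {c : Fin d → ℝ} {k : ℕ}
    (ht : ∀ ℓ, 0 < boxSide c k ℓ) (hγ : ∀ ℓ, 0 < γ ℓ) (hg : ∀ ℓ, γ ℓ ≤ g ℓ)
    (hgt : ∀ ℓ, 2 * g ℓ ≤ boxSide c k ℓ)
    (hmix : ∀ A B : Set (Fin d → ℤ), A ⊆ K → B ⊆ K → IsSeparated γ A B → (IsBox A ∨ IsBox B) →
      |probMaxLE P ξ (A ∪ B) x - probMaxLE P ξ A x * probMaxLE P ξ B x| ≤ α)
    (hKt : Set.Icc (fun ℓ => -boxSide c k ℓ) (fun ℓ => 2 * boxSide c k ℓ - 1) ⊆ K) {T T' : ℝ}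
    (hT : T = ∏ ℓ, (boxSide c k ℓ : ℝ)) (hT' : T' = ∏ ℓ, ((boxSide c k ℓ : ℝ) - 2 * g ℓ)) :
    1 - probMaxLE P ξ (cellPoints (boxSide c k) 0) x ≤
      T * P.real (lastExceedance ξ prec c k x 0) + (T - T') * P.real {ω | x < ξ 0 ω} +
        (T * P.real {ω | x < ξ 0 ω}) * (3 ^ d * (T * P.real {ω | x < ξ 0 ω})) + α := by
  classical
  have hg0 : ∀ ℓ, 0 ≤ g ℓ := fun ℓ => by exact_mod_cast ((hγ ℓ).trans_le (hg ℓ)).le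
  set t := boxSide c k
  set q := P.real {ω | x < ξ 0 ω}
  have hq0 : 0 ≤ q := measureReal_nonneg
  set J := cellPoints t 0
  set J' := cellCore t g 0
  set L : Finset (Fin d → ℤ) := Finset.Icc (fun ℓ => -t ℓ) (fun ℓ => 2 * t ℓ - 1)
  have hJ'J : J' ⊆ J := cellCore_subset hg0
  have hJL : J ⊆ L := by
    intro v hv
    rw [mem_cellPoints] at hv
    refine Finset.mem_Icc.2 ⟨fun ℓ => ?_, fun ℓ => ?_⟩ <;> have h1 := hv ℓ <;>
      have h2 := ht ℓ <;> simp only [Pi.zero_apply, zero_mul, zero_add, one_mul] at h1 <;>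
      dsimp only <;> linarith
  have hLK : (L : Set (Fin d → ℤ)) ⊆ K := by
    rw [Finset.coe_Icc]
    exact hKt
  have hcardJ : (J.card : ℝ) = T := by rw [hT]; exact card_cellPoints ht
  have hcardJ' : (J'.card : ℝ) = T' := by rw [hT']; exact card_cellCore hgt
  have hcardL : (L.card : ℝ) = 3 ^ d * T := by
    rw [Pi.card_Icc, Nat.cast_prod, hT]
    have h3 : (3 : ℝ) ^ d = ∏ _ℓ : Fin d, (3 : ℝ) := by simp
    rw [h3, ← Finset.prod_mul_distrib]
    refine Finset.prod_congr rfl fun ℓ _ => ?_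
    have h1 := ht ℓ
    rw [Int.card_Icc, ← Int.cast_natCast, Int.toNat_of_nonneg (by linarith)]
    push_cast
    ring
  have h1 := hstat.one_sub_probMaxLE_le_card_mul_add (x := x) (c := c) (k := k) hξ hprec J (L \ J)
    (by
      intro v hv z hz
      rw [← Finset.coe_union, Finset.union_sdiff_of_subset hJL]
      rw [mem_cellPoints] at hv
      rw [Finset.coe_Icc]
      refine ⟨fun ℓ => ?_, fun ℓ => ?_⟩ <;> have h1 := hv ℓ <;>
        have h2 := abs_le.1 (hz.1 ℓ) <;>
        simp only [Pi.zero_apply, zero_mul, zero_add, one_mul] at h1 <;>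
        dsimp only <;> linarith)
  have h2 : P.real ({ω | ∃ v ∈ J, x < ξ v ω} ∩ {ω | ∃ v ∈ L \ J, x < ξ v ω}) ≤
      P.real ({ω | ∃ v ∈ (J' : Set (Fin d → ℤ)), x < ξ v ω} ∩
        {ω | ∃ v ∈ ((L \ J : Finset (Fin d → ℤ)) : Set (Fin d → ℤ)), x < ξ v ω}) +
      P.real {ω | ∃ v ∈ ((J \ J' : Finset (Fin d → ℤ)) : Set (Fin d → ℤ)), x < ξ v ω} := by
    refine (measureReal_mono ?_).trans (measureReal_union_le _ _)
    rintro ω ⟨⟨v, hv, hxv⟩, hB⟩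
    by_cases hvJ : v ∈ J'
    · exact Or.inl ⟨⟨v, hvJ, hxv⟩, hB⟩
    · exact Or.inr ⟨v, Finset.mem_coe.2 (Finset.mem_sdiff.2 ⟨hv, hvJ⟩), hxv⟩
  have h3 := real_exceedances_inter_le hξ (hmix J' (L \ J : Finset (Fin d → ℤ))
    ((Finset.coe_subset.2 (hJ'J.trans hJL)).trans hLK)
    ((Finset.coe_subset.2 Finset.sdiff_subset).trans hLK)
    (isSeparated_cellCore hγ hg 0 fun v hv => (Finset.mem_sdiff.1 (Finset.mem_coe.1 hv)).2)
    (Or.inl ⟨_, _, Finset.coe_Icc _ _⟩))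
  have h4 := hstat.one_sub_probMaxLE_le hξ (J \ J') x
  rw [← real_exists_lt hξ, Finset.card_sdiff_of_subset hJ'J,
    Nat.cast_sub (Finset.card_le_card hJ'J), hcardJ, hcardJ'] at h4
  have h5 : (1 - probMaxLE P ξ J' x) * (1 - probMaxLE P ξ (L \ J : Finset (Fin d → ℤ)) x) ≤
      (T * q) * (3 ^ d * (T * q)) := by
    have h6 : 1 - probMaxLE P ξ J' x ≤ T * q := by
      refine (hstat.one_sub_probMaxLE_le hξ J' x).trans ?_
      rw [← hcardJ]
      gcongr
    have h7 : 1 - probMaxLE P ξ (L \ J : Finset (Fin d → ℤ)) x ≤ 3 ^ d * (T * q) := by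
      refine (hstat.one_sub_probMaxLE_le hξ (L \ J) x).trans ?_
      rw [← mul_assoc, ← hcardL]
      gcongr
      exact Finset.sdiff_subset
    refine mul_le_mul h6 h7 (sub_nonneg.2 (probMaxLE_le_one _ _)) ?_
    rw [← hcardJ]
    positivity
  rw [hcardJ] at h1
  linarith

end Mixing

/-! ### Asymptotics of the grid -/

section Grid

variable {d : ℕ} {c : ℕ → Fin d → ℝ} {k : ℕ → ℕ} {γ : ℕ → Fin d → ℝ}

theorem tendsto_div_root_atTop (hpos : ∀ n ℓ, 0 < γ n ℓ) (hmono : Monotone γ)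
    (hc : ∀ n ℓ, 0 < c n ℓ) (hk : Tendsto k atTop atTop) (ℓ : Fin d)
    (hkγ : (fun n => (k n : ℝ) ^ (1 / (d : ℝ)) * γ n ℓ) =o[atTop] (fun n => c n ℓ)) :
    Tendsto (fun n => c n ℓ / (k n : ℝ) ^ (1 / (d : ℝ))) atTop atTop := by
  have hκ : ∀ᶠ n in atTop, 0 < (k n : ℝ) ^ (1 / (d : ℝ)) := by
    filter_upwards [hk.eventually_gt_atTop 0] with n hn
    have : (0 : ℝ) < k n := by exact_mod_cast hn
    positivity
  have h1 : Tendsto (fun n => ((k n : ℝ) ^ (1 / (d : ℝ)) * γ n ℓ / c n ℓ)⁻¹) atTop atTop := by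
    refine Tendsto.inv_tendsto_nhdsGT_zero
      (tendsto_nhdsWithin_iff.2 ⟨hkγ.tendsto_div_nhds_zero, ?_⟩)
    filter_upwards [hκ] with n hn
    exact div_pos (mul_pos hn (hpos n ℓ)) (hc n ℓ)
  refine tendsto_atTop_mono' _ ?_ (h1.const_mul_atTop (hpos 0 ℓ))
  filter_upwards [hκ] with n hn
  have h2 : γ 0 ℓ ≤ γ n ℓ := hmono (Nat.zero_le n) ℓ
  have h3 := hpos n ℓ
  have h4 := hc n ℓ
  calc γ 0 ℓ * ((k n : ℝ) ^ (1 / (d : ℝ)) * γ n ℓ / c n ℓ)⁻¹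
      ≤ γ n ℓ * ((k n : ℝ) ^ (1 / (d : ℝ)) * γ n ℓ / c n ℓ)⁻¹ := by gcongr
    _ = _ := by field_simp

theorem tendsto_boxSide_div {ℓ : Fin d}
    (h : Tendsto (fun n => c n ℓ / (k n : ℝ) ^ (1 / (d : ℝ))) atTop atTop) :
    Tendsto (fun n => (boxSide (c n) (k n) ℓ : ℝ) / (c n ℓ / (k n : ℝ) ^ (1 / (d : ℝ))))
      atTop (𝓝 1) := by
  have h1 : Tendsto (fun n => 1 - (c n ℓ / (k n : ℝ) ^ (1 / (d : ℝ)))⁻¹) atTop (𝓝 (1 - 0)) :=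
    tendsto_const_nhds.sub h.inv_tendsto_atTop
  rw [sub_zero] at h1
  refine tendsto_of_tendsto_of_tendsto_of_le_of_le' h1 tendsto_const_nhds ?_ ?_
  · filter_upwards [h.eventually_gt_atTop 0] with n hn
    have := Int.lt_floor_add_one (c n ℓ / (k n : ℝ) ^ (1 / (d : ℝ)))
    rw [le_div_iff₀ hn, sub_mul, inv_mul_cancel₀ hn.ne', boxSide]
    linarith
  · filter_upwards [h.eventually_gt_atTop 0] with n hn
    rw [div_le_one hn]
    exact Int.floor_le _

theorem tendsto_boxSide_atTop {ℓ : Fin d}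
    (h : Tendsto (fun n => c n ℓ / (k n : ℝ) ^ (1 / (d : ℝ))) atTop atTop) :
    Tendsto (fun n => (boxSide (c n) (k n) ℓ : ℝ)) atTop atTop := by
  refine tendsto_atTop_mono (fun n => ?_) (tendsto_atTop_add_const_right _ (-1) h)
  have := Int.lt_floor_add_one (c n ℓ / (k n : ℝ) ^ (1 / (d : ℝ)))
  rw [boxSide]
  linarith

theorem tendsto_ceil_gap_div_boxSide (hpos : ∀ n ℓ, 0 < γ n ℓ) {ℓ : Fin d}
    (h : Tendsto (fun n => c n ℓ / (k n : ℝ) ^ (1 / (d : ℝ))) atTop atTop)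
    (hkγ : (fun n => (k n : ℝ) ^ (1 / (d : ℝ)) * γ n ℓ) =o[atTop] (fun n => c n ℓ)) :
    Tendsto (fun n => (⌈γ n ℓ⌉ : ℝ) / boxSide (c n) (k n) ℓ) atTop (𝓝 0) := by
  have h1 := tendsto_boxSide_div h
  have h2 : Tendsto (fun n => (((k n : ℝ) ^ (1 / (d : ℝ)) * γ n ℓ / c n ℓ) +
      (c n ℓ / (k n : ℝ) ^ (1 / (d : ℝ)))⁻¹) *
      ((boxSide (c n) (k n) ℓ : ℝ) / (c n ℓ / (k n : ℝ) ^ (1 / (d : ℝ))))⁻¹) atTop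
      (𝓝 ((0 + 0) * 1⁻¹)) :=
    (hkγ.tendsto_div_nhds_zero.add h.inv_tendsto_atTop).mul (h1.inv₀ one_ne_zero)
  simp only [add_zero, zero_mul] at h2
  refine tendsto_of_tendsto_of_tendsto_of_le_of_le' tendsto_const_nhds h2 ?_ ?_
  · filter_upwards [(tendsto_boxSide_atTop h).eventually_gt_atTop 0] with n hn
    have : (0 : ℝ) < ⌈γ n ℓ⌉ := by exact_mod_cast Int.ceil_pos.2 (hpos n ℓ)
    positivity
  · filter_upwards [(tendsto_boxSide_atTop h).eventually_gt_atTop 0, h.eventually_gt_atTop 0]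
      with n hn hn'
    have h3 := (Int.ceil_lt_add_one (γ n ℓ)).le
    have h4 : (k n : ℝ) ^ (1 / (d : ℝ)) ≠ 0 := by
      intro h0
      rw [h0, div_zero] at hn'
      exact hn'.false
    have h5 : c n ℓ ≠ 0 := by
      intro h0
      simp [h0] at hn'
    calc (⌈γ n ℓ⌉ : ℝ) / boxSide (c n) (k n) ℓ ≤ (γ n ℓ + 1) / boxSide (c n) (k n) ℓ := by
          gcongr
      _ = _ := by field_simp

theorem tendsto_prod_sub_div_prod {t g : ℕ → Fin d → ℤ}
    (h : ∀ ℓ, Tendsto (fun n => (g n ℓ : ℝ) / t n ℓ) atTop (𝓝 0))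
    (ht : ∀ᶠ n in atTop, ∀ ℓ, 0 < t n ℓ) :
    Tendsto (fun n => (∏ ℓ, ((t n ℓ : ℝ) - 2 * g n ℓ)) / ∏ ℓ, (t n ℓ : ℝ)) atTop (𝓝 1) := by
  have h1 : Tendsto (fun n => ∏ ℓ, (1 - 2 * ((g n ℓ : ℝ) / t n ℓ))) atTop
      (𝓝 (∏ _ℓ : Fin d, (1 - 2 * (0 : ℝ)))) :=
    tendsto_finsetProd _ fun ℓ _ => tendsto_const_nhds.sub ((h ℓ).const_mul 2)
  simp only [mul_zero, sub_zero, Finset.prod_const_one] at h1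
  refine h1.congr' ?_
  filter_upwards [ht] with n hn
  rw [← Finset.prod_div_distrib]
  refine Finset.prod_congr rfl fun ℓ _ => ?_
  have : (t n ℓ : ℝ) ≠ 0 := by exact_mod_cast (hn ℓ).ne'
  field_simp

theorem tendsto_natRoot_atTop (hd : d ≠ 0) (hk : Tendsto k atTop atTop) :
    Tendsto (fun n => (k n : ℝ) ^ (1 / (d : ℝ))) atTop atTop := by
  have : (0 : ℝ) < 1 / d := by positivity
  exact (tendsto_rpow_atTop this).comp (tendsto_natCast_atTop_atTop.comp hk)

theorem natRoot_pow (hd : d ≠ 0) (m : ℕ) : ((m : ℝ) ^ (1 / (d : ℝ))) ^ d = m := by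
  rw [one_div]
  exact Real.rpow_inv_natCast_pow m.cast_nonneg hd

variable {p : ℕ} {D : ℕ → Set (Fin d → ℤ)} {C : ℕ → Set (Fin d → ℝ)}

theorem GeometricAssumption.dim_ne_zero (hD : GeometricAssumption p D C c) : d ≠ 0 := by
  rintro rfl
  have h1 : Tendsto (fun n => (∏ ℓ, c n ℓ) / (volume (C n)).toReal) atTop (𝓝 0) := by
    simp only [Finset.univ_eq_empty, Finset.prod_empty]
    exact hD.volume_tendsto.inv_tendsto_atTop.congr fun n => (one_div _).symm
  have h2 := (isEquivalent_iff_tendsto_one (hD.volume_tendsto.eventually_ne_atTop 0)).1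
    hD.scaling_prod
  exact zero_ne_one (tendsto_nhds_unique h1 h2)

/-- Any `k` cells together have asymptotically the volume of `C`. -/
theorem GeometricAssumption.tendsto_volume_div (hD : GeometricAssumption p D C c)
    (hk : Tendsto k atTop atTop)
    (h : ∀ ℓ, Tendsto (fun n => c n ℓ / (k n : ℝ) ^ (1 / (d : ℝ))) atTop atTop) :
    Tendsto (fun n => (volume (C n)).toReal / (k n * ∏ ℓ, (boxSide (c n) (k n) ℓ : ℝ))) atTop
      (𝓝 1) := by
  have h1 := (isEquivalent_iff_tendsto_one (hD.volume_tendsto.eventually_ne_atTop 0)).1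
    hD.scaling_prod
  have h2 : Tendsto (fun n => ∏ ℓ, (boxSide (c n) (k n) ℓ : ℝ) /
      (c n ℓ / (k n : ℝ) ^ (1 / (d : ℝ)))) atTop (𝓝 (∏ _ℓ : Fin d, (1 : ℝ))) :=
    tendsto_finsetProd _ fun ℓ _ => tendsto_boxSide_div (h ℓ)
  rw [Finset.prod_const_one] at h2
  have h3 := (h1.mul h2).inv₀ (by norm_num)
  simp only [mul_one, inv_one] at h3
  refine h3.congr' ?_
  filter_upwards [hk.eventually_gt_atTop 0, hD.volume_tendsto.eventually_gt_atTop 0,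
    eventually_all.2 fun ℓ => (tendsto_boxSide_atTop (h ℓ)).eventually_gt_atTop 0] with n hn hV ht
  have hk0 : (k n : ℝ) ≠ 0 := by exact_mod_cast hn.ne'
  have hc0 : ∏ ℓ, c n ℓ ≠ 0 := Finset.prod_ne_zero_iff.2 fun ℓ _ => (hD.scaling_pos n ℓ).ne'
  have ht0 : ∏ ℓ, (boxSide (c n) (k n) ℓ : ℝ) ≠ 0 :=
    Finset.prod_ne_zero_iff.2 fun ℓ _ => (ht ℓ).ne'
  rw [Finset.prod_div_distrib, Finset.prod_div_distrib, Finset.prod_const, Finset.card_univ,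
    Fintype.card_fin, natRoot_pow hD.dim_ne_zero]
  simp only [Pi.div_apply]
  field_simp

theorem GeometricAssumption.exists_outerCells_bound (hD : GeometricAssumption p D C c)
    (hk : Tendsto k atTop atTop)
    (h : ∀ ℓ, Tendsto (fun n => c n ℓ / (k n : ℝ) ^ (1 / (d : ℝ))) atTop atTop) :
    ∃ R : ℝ, 0 < R ∧ ∀ᶠ n in atTop, ∃ M : ℕ, 4 * (M : ℝ) + 1 ≤ R * (k n : ℝ) ^ (1 / (d : ℝ)) ∧
      outerCells (boxSide (c n) (k n)) (C n) ⊆ Set.Icc (fun _ => -(M : ℤ)) (fun _ => (M : ℤ)) := by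
  obtain ⟨r, hr, hsub⟩ := hD.subset_box
  refine ⟨8 * r + 9, by linarith, ?_⟩
  have h1 : ∀ᶠ n in atTop, ∀ ℓ, 1 / 2 < (boxSide (c n) (k n) ℓ : ℝ) /
      (c n ℓ / (k n : ℝ) ^ (1 / (d : ℝ))) :=
    eventually_all.2 fun ℓ => (tendsto_boxSide_div (h ℓ)).eventually_const_lt (by norm_num)
  filter_upwards [h1, eventually_all.2 fun ℓ => (tendsto_boxSide_atTop (h ℓ)).eventually_gt_atTop 0,
    (tendsto_natRoot_atTop hD.dim_ne_zero hk).eventually_ge_atTop 1] with n hn ht hκ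
  set κ := (k n : ℝ) ^ (1 / (d : ℝ))
  have hκ0 : 0 < κ := by linarith
  refine ⟨⌈2 * r * κ⌉₊ + 1, ?_, ?_⟩
  · have h2 := (Nat.ceil_lt_add_one (show 0 ≤ 2 * r * κ by positivity)).le
    push_cast
    nlinarith
  · refine outerCells_subset (r := fun ℓ => c n ℓ * r) (fun ℓ => by exact_mod_cast ht ℓ) ?_ ?_
    · intro u hu ℓ
      obtain ⟨a, ha, rfl⟩ := hsub n hu
      have hc := hD.scaling_pos n ℓ
      dsimp only
      rw [abs_mul, abs_of_pos hc]
      exact mul_le_mul_of_nonneg_left (abs_le.2 ⟨ha.1 ℓ, ha.2 ℓ⟩) hc.le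
    · intro ℓ
      have hc := hD.scaling_pos n ℓ
      have h3 := hn ℓ
      rw [lt_div_iff₀ (div_pos hc hκ0)] at h3
      have h4 : c n ℓ * r / boxSide (c n) (k n) ℓ ≤ 2 * r * κ := by
        rw [div_le_iff₀ (ht ℓ)]
        calc c n ℓ * r = 2 * r * κ * (1 / 2 * (c n ℓ / κ)) := by field_simp
          _ ≤ _ := by gcongr
      push_cast
      exact add_le_add (h4.trans (Nat.le_ceil _)) le_rfl

theorem GeometricAssumption.eventually_finite_outerCells (hD : GeometricAssumption p D C c)
    (hk : Tendsto k atTop atTop)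
    (h : ∀ ℓ, Tendsto (fun n => c n ℓ / (k n : ℝ) ^ (1 / (d : ℝ))) atTop atTop) :
    ∀ᶠ n in atTop, (outerCells (boxSide (c n) (k n)) (C n)).Finite := by
  obtain ⟨R, -, hR⟩ := hD.exists_outerCells_bound hk h
  filter_upwards [hR] with n ⟨M, _, hM⟩
  exact (Set.finite_Icc _ _).subset hM

theorem GeometricAssumption.volume_ne_top (hD : GeometricAssumption p D C c) (n : ℕ) :
    volume (C n) ≠ ⊤ := by
  obtain ⟨B, hB, h⟩ := hD.pConvex n
  rw [h]
  exact (isCompact_iUnion fun i => (hB i).2.1).measure_ne_top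

theorem eventually_boxSide_pos
    (h : ∀ ℓ, Tendsto (fun n => c n ℓ / (k n : ℝ) ^ (1 / (d : ℝ))) atTop atTop) :
    ∀ᶠ n in atTop, ∀ ℓ, 0 < boxSide (c n) (k n) ℓ := by
  filter_upwards [eventually_all.2 fun ℓ => (tendsto_boxSide_atTop (h ℓ)).eventually_gt_atTop 0]
    with n hn ℓ
  exact_mod_cast hn ℓ

/-- The boundary cells number `O(k ^ ((d - 1) / d))`. -/
theorem GeometricAssumption.tendsto_boundary_div (hD : GeometricAssumption p D C c)
    (hk : Tendsto k atTop atTop)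
    (h : ∀ ℓ, Tendsto (fun n => c n ℓ / (k n : ℝ) ^ (1 / (d : ℝ))) atTop atTop) :
    Tendsto (fun n => ((outerCells (boxSide (c n) (k n)) (C n)).ncard : ℝ) / k n -
      ((innerCells (boxSide (c n) (k n)) (C n)).ncard : ℝ) / k n) atTop (𝓝 0) := by
  obtain ⟨R, hR0, hR⟩ := hD.exists_outerCells_bound hk h
  have hd := hD.dim_ne_zero
  have h1 := (tendsto_natRoot_atTop hd hk).inv_tendsto_atTop.const_mul (p * (2 ^ d * R ^ (d - 1)))
  rw [mul_zero] at h1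
  refine tendsto_of_tendsto_of_tendsto_of_le_of_le' tendsto_const_nhds h1 ?_ ?_
  · filter_upwards [hD.eventually_finite_outerCells hk h, eventually_boxSide_pos h] with n hfin ht
    rw [sub_nonneg]
    exact div_le_div_of_nonneg_right (Nat.cast_le.2
      (Set.ncard_le_ncard (innerCells_subset_outerCells ht _) hfin)) (Nat.cast_nonneg _)
  · filter_upwards [hR, eventually_boxSide_pos h, hk.eventually_gt_atTop 0]
      with n ⟨M, hM, hsub⟩ ht hn
    have h2 := ncard_outerCells_le ⟨0, Nat.pos_of_ne_zero hd⟩ ht (hD.pConvex n) hsub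
    have h3 : ((outerCells (boxSide (c n) (k n)) (C n)).ncard : ℝ) ≤
        (innerCells (boxSide (c n) (k n)) (C n)).ncard +
          p * (2 ^ d * (4 * (M : ℝ) + 1) ^ (d - 1)) := by exact_mod_cast h2
    have hk0 : (0 : ℝ) < k n := by exact_mod_cast hn
    have hκ := natRoot_pow hd (k n)
    have hκ0 : 0 < (k n : ℝ) ^ (1 / (d : ℝ)) := by positivity
    rw [Pi.inv_apply]
    set κ := (k n : ℝ) ^ (1 / (d : ℝ))
    rw [← sub_div, div_le_iff₀ hk0]
    calc _ ≤ p * (2 ^ d * (4 * (M : ℝ) + 1) ^ (d - 1)) := by linarith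
      _ ≤ p * (2 ^ d * (R * κ) ^ (d - 1)) := by gcongr
      _ = p * (2 ^ d * R ^ (d - 1)) * κ⁻¹ * κ ^ d := by
        rw [mul_pow, ← Nat.sub_add_cancel (Nat.one_le_iff_ne_zero.2 hd), pow_succ κ,
          Nat.add_sub_cancel]
        field_simp
      _ = _ := by rw [hκ]

theorem GeometricAssumption.tendsto_ncard_outerCells_div (hD : GeometricAssumption p D C c)
    (hk : Tendsto k atTop atTop)
    (h : ∀ ℓ, Tendsto (fun n => c n ℓ / (k n : ℝ) ^ (1 / (d : ℝ))) atTop atTop) :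
    Tendsto (fun n => ((outerCells (boxSide (c n) (k n)) (C n)).ncard : ℝ) / k n)
      atTop (𝓝 1) := by
  have h1 := hD.tendsto_volume_div hk h
  have h2 := h1.add (hD.tendsto_boundary_div hk h)
  rw [add_zero] at h2
  have key : ∀ᶠ n in atTop, (0 : ℝ) < k n ∧ (0 : ℝ) < ∏ ℓ, (boxSide (c n) (k n) ℓ : ℝ) := by
    filter_upwards [eventually_boxSide_pos h, hk.eventually_gt_atTop 0] with n ht hn
    exact ⟨by exact_mod_cast hn, Finset.prod_pos fun ℓ _ => by exact_mod_cast ht ℓ⟩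
  refine tendsto_of_tendsto_of_tendsto_of_le_of_le' h1 h2 ?_ ?_
  · filter_upwards [hD.eventually_finite_outerCells hk h, eventually_boxSide_pos h, key]
      with n hfin ht ⟨hk0, hT⟩
    rw [div_le_div_iff₀ (by positivity) hk0]
    have := volume_le_ncard_outerCells_mul ht hfin
    nlinarith
  · filter_upwards [hD.eventually_finite_outerCells hk h, eventually_boxSide_pos h, key]
      with n hfin ht ⟨hk0, hT⟩
    have h3 := ncard_innerCells_mul_le_volume ht
      (hfin.subset (innerCells_subset_outerCells ht _)) (hD.volume_ne_top n)
    have h4 : ((innerCells (boxSide (c n) (k n)) (C n)).ncard : ℝ) / k n ≤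
        (volume (C n)).toReal / (k n * ∏ ℓ, (boxSide (c n) (k n) ℓ : ℝ)) := by
      rw [div_le_div_iff₀ hk0 (by positivity)]
      nlinarith
    linarith

theorem GeometricAssumption.tendsto_ncard_innerCells_div (hD : GeometricAssumption p D C c)
    (hk : Tendsto k atTop atTop)
    (h : ∀ ℓ, Tendsto (fun n => c n ℓ / (k n : ℝ) ^ (1 / (d : ℝ))) atTop atTop) :
    Tendsto (fun n => ((innerCells (boxSide (c n) (k n)) (C n)).ncard : ℝ) / k n)
      atTop (𝓝 1) := by
  simpa using (hD.tendsto_ncard_outerCells_div hk h).sub (hD.tendsto_boundary_div hk h)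

theorem GeometricAssumption.tendsto_ncard_div (hD : GeometricAssumption p D C c)
    (hk : Tendsto k atTop atTop)
    (h : ∀ ℓ, Tendsto (fun n => c n ℓ / (k n : ℝ) ^ (1 / (d : ℝ))) atTop atTop) :
    Tendsto (fun n => ((D n).ncard : ℝ) / (k n * ∏ ℓ, (boxSide (c n) (k n) ℓ : ℝ)))
      atTop (𝓝 1) := by
  refine tendsto_of_tendsto_of_tendsto_of_le_of_le' (hD.tendsto_ncard_innerCells_div hk h)
    (hD.tendsto_ncard_outerCells_div hk h) ?_ ?_
  all_goals
    filter_upwards [hD.eventually_finite_outerCells hk h, eventually_boxSide_pos h,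
      hk.eventually_gt_atTop 0] with n hfin ht hn
    have hk0 : (0 : ℝ) < k n := by exact_mod_cast hn
    have hT : (0 : ℝ) < ∏ ℓ, (boxSide (c n) (k n) ℓ : ℝ) :=
      Finset.prod_pos fun ℓ _ => by exact_mod_cast ht ℓ
    rw [hD.index_eq n, div_le_div_iff₀ (by positivity) (by positivity)]
  · have := le_ncard_latticePoints ht hfin
    nlinarith
  · have := ncard_latticePoints_le ht hfin
    nlinarith

end Grid

/-! ### Exponential limits -/

section Exponential

theorem tendsto_mul_zero_of_isBigO_one {s e : ℕ → ℝ} (hs : s =O[atTop] fun _ => (1 : ℝ))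
    (he : Tendsto e atTop (𝓝 0)) : Tendsto (fun n => s n * e n) atTop (𝓝 0) := by
  have h := hs.mul_isLittleO ((isLittleO_one_iff ℝ).2 he)
  simpa using h

theorem tendsto_exp_neg_sub_exp_neg {a b : ℕ → ℝ} (hb : ∀ n, 0 ≤ b n)
    (h : Tendsto (fun n => a n - b n) atTop (𝓝 0)) :
    Tendsto (fun n => Real.exp (-a n) - Real.exp (-b n)) atTop (𝓝 0) := by
  have h1 : (fun n => Real.exp (-b n)) =O[atTop] fun _ => (1 : ℝ) := by
    refine IsBigO.of_bound 1 (Eventually.of_forall fun n => ?_)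
    rw [Real.norm_eq_abs, Real.abs_exp, norm_one, mul_one]
    exact Real.exp_le_one_iff.2 (by linarith [hb n])
  have h2 : Tendsto (fun n => Real.exp (-(a n - b n)) - 1) atTop (𝓝 0) := by
    simpa using ((Real.continuous_exp.tendsto _).comp h.neg).sub_const 1
  refine (tendsto_mul_zero_of_isBigO_one h1 h2).congr fun n => ?_
  rw [mul_sub, ← Real.exp_add, mul_one]
  congr 2
  ring

/-- A bound `F ≤ exp (-s u) + e` keeps `s` bounded as long as `F` stays away from `0`. -/
theorem isBigO_one_of_le_exp {s u e F : ℕ → ℝ} {θ L : ℝ} (hs : ∀ n, 0 ≤ s n) (hθ : 0 < θ)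
    (hL : 0 < L) (hu : Tendsto u atTop (𝓝 θ)) (he : Tendsto e atTop (𝓝 0))
    (hF : Tendsto F atTop (𝓝 L)) (h : ∀ᶠ n in atTop, F n ≤ Real.exp (-(s n * u n)) + e n) :
    s =O[atTop] fun _ => (1 : ℝ) := by
  refine IsBigO.of_bound (2 * -Real.log (L / 4) / θ) ?_
  filter_upwards [h, hF.eventually_const_lt (half_lt_self hL),
    he.eventually_lt_const (show 0 < L / 4 by linarith),
    hu.eventually_const_lt (half_lt_self hθ)] with n h1 h2 h3 h4
  have h5 : Real.log (L / 4) ≤ -(s n * u n) :=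
    (Real.log_le_iff_le_exp (by linarith)).2 (by linarith)
  rw [norm_one, mul_one, Real.norm_of_nonneg (hs n), le_div_iff₀ hθ]
  nlinarith [hs n]

theorem exp_neg_le_one_sub_pow {δ : ℝ} (hδ : δ < 1) (N : ℕ) :
    Real.exp (-(N * δ / (1 - δ))) ≤ (1 - δ) ^ N := by
  have h : Real.exp (-(δ / (1 - δ))) ≤ 1 - δ := by
    rw [← Real.le_log_iff_exp_le (by linarith)]
    refine le_trans (le_of_eq ?_) (Real.one_sub_inv_le_log_of_pos (by linarith))
    have : 1 - δ ≠ 0 := by linarith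
    field_simp
    ring
  calc Real.exp (-(N * δ / (1 - δ))) = Real.exp (-(δ / (1 - δ))) ^ N := by
        rw [← Real.exp_nat_mul]
        congr 1
        ring
    _ ≤ _ := pow_le_pow_left₀ (Real.exp_pos _).le h N

theorem tendsto_exp_neg_div_one_sub {N : ℕ → ℕ} {δ s : ℕ → ℝ} (hs0 : ∀ n, 0 ≤ s n)
    (hs : s =O[atTop] fun _ => (1 : ℝ)) (hN : Tendsto N atTop atTop)
    (h : Tendsto (fun n => N n * δ n - s n) atTop (𝓝 0)) :
    Tendsto δ atTop (𝓝 0) ∧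
      Tendsto (fun n => Real.exp (-(N n * δ n / (1 - δ n))) - Real.exp (-s n)) atTop (𝓝 0) := by
  have hNδ : (fun n => N n * δ n) =O[atTop] fun _ => (1 : ℝ) := by
    have h1 : (fun n => N n * δ n - s n) =O[atTop] fun _ => (1 : ℝ) := h.isBigO_one ℝ
    simpa using h1.add hs
  have hδ : Tendsto δ atTop (𝓝 0) := by
    refine (tendsto_mul_zero_of_isBigO_one hNδ
      (tendsto_inv_atTop_zero.comp (tendsto_natCast_atTop_atTop.comp hN))).congr' ?_
    filter_upwards [hN.eventually_gt_atTop 0] with n hn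
    have : (N n : ℝ) ≠ 0 := by exact_mod_cast hn.ne'
    simp only [Function.comp_apply]
    field_simp
  refine ⟨hδ, tendsto_exp_neg_sub_exp_neg hs0 ?_⟩
  have h1 : Tendsto (fun n => δ n / (1 - δ n)) atTop (𝓝 (0 / (1 - 0))) :=
    hδ.div (tendsto_const_nhds.sub hδ) (by norm_num)
  rw [zero_div] at h1
  have h2 := (tendsto_mul_zero_of_isBigO_one hNδ h1).add h
  rw [add_zero] at h2
  refine h2.congr' ?_
  filter_upwards [hδ.eventually_lt_const zero_lt_one] with n hn
  have : 1 - δ n ≠ 0 := by linarith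
  field_simp
  ring

end Exponential

/-! ### Comparison of the maximum over the index set with independent blocks -/

section Comparison

variable {d : ℕ} {t g : Fin d → ℤ} {γ : Fin d → ℝ} {Ω : Type*} [MeasurableSpace Ω]
  {P : Measure Ω} [IsProbabilityMeasure P] {ξ : (Fin d → ℤ) → Ω → ℝ} {x : ℝ}
  {K : Set (Fin d → ℤ)} {α : ℝ} {C : Set (Fin d → ℝ)}

theorem cellPoints_subset_outerApprox {c : Fin d → ℝ} {k : ℕ} {z : Fin d → ℤ}
    (hz : z ∈ outerCells (boxSide c k) C) :
    (cellPoints (boxSide c k) z : Set (Fin d → ℤ)) ⊆ outerApprox C c k :=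
  fun _ hv => mem_biUnion (show z ∈ {z | (gridBox c k z ∩ C).Nonempty} from hz)
    (toReal_mem_cell.2 hv)

/-- The upper bound: the shrunk inner cells are nearly independent, and each of them holds an
exceedance at least with the probability given by the last exceedances. -/
theorem IsStationary.probMaxLE_latticePoints_le (hstat : IsStationary P ξ)
    (hξ : ∀ v, Measurable (ξ v)) {prec : (Fin d → ℤ) → (Fin d → ℤ) → Prop}
    (hprec : IsTranslationInvariantOrder prec) {c : Fin d → ℝ} {k : ℕ}
    (ht : ∀ ℓ, 0 < boxSide c k ℓ) (hγ : ∀ ℓ, 0 < γ ℓ) (hg : ∀ ℓ, γ ℓ ≤ g ℓ)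
    (hgt : ∀ ℓ, 2 * g ℓ ≤ boxSide c k ℓ)
    (hmix : ∀ A B : Set (Fin d → ℤ), A ⊆ K → B ⊆ K → IsSeparated γ A B → (IsBox A ∨ IsBox B) →
      |probMaxLE P ξ (A ∪ B) x - probMaxLE P ξ A x * probMaxLE P ξ B x| ≤ α)
    (hK : outerApprox C c k ⊆ K) (hfin : (outerCells (boxSide c k) C).Finite) :
    probMaxLE P ξ (latticePoints C) x ≤
      Real.exp (-((innerCells (boxSide c k) C).ncard *
        ((∏ ℓ, ((boxSide c k ℓ : ℝ) - 2 * g ℓ)) * P.real (lastExceedance ξ prec c k x 0)))) +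
      (innerCells (boxSide c k) C).ncard * α := by
  classical
  have hg0 : ∀ ℓ, 0 ≤ g ℓ := fun ℓ => by exact_mod_cast ((hγ ℓ).trans_le (hg ℓ)).le
  set t := boxSide c k
  have hin := innerCells_subset_outerCells ht C
  have hfin' := hfin.subset hin
  rw [Set.ncard_eq_toFinset_card _ hfin']
  set S := hfin'.toFinset
  have h1 := hstat.abs_probMaxLE_biUnion_cellCore_sub_le hξ hmix ht hγ hg S
    fun z hz => (cellPoints_subset_outerApprox (hin (hfin'.mem_toFinset.1 hz))).trans hK
  have h2 : probMaxLE P ξ (latticePoints C) x ≤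
      probMaxLE P ξ (S.biUnion (cellCore t g) : Finset (Fin d → ℤ)) x := by
    refine probMaxLE_anti (Set.Subset.trans ?_ (biUnion_subset_latticePoints hfin')) x
    exact Finset.coe_subset.2 (Finset.biUnion_mono fun z _ => cellCore_subset hg0)
  have h3 := hstat.card_mul_le_one_sub_probMaxLE (x := x) (c := c) (k := k) hξ hprec
    (cellCore t g 0) (by
      intro v hv w hw ℓ
      have hv' := mem_cellPoints.1 (cellCore_subset hg0 hv) ℓ
      have hw' := mem_cellPoints.1 (cellCore_subset hg0 hw) ℓ
      simp only [Pi.zero_apply, zero_mul, zero_add, one_mul] at hv' hw'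
      exact abs_le.2 ⟨by linarith, by linarith⟩)
  rw [card_cellCore hgt] at h3
  set y := (∏ ℓ, ((t ℓ : ℝ) - 2 * g ℓ)) * P.real (lastExceedance ξ prec c k x 0)
  have h4 : probMaxLE P ξ (cellCore t g 0) x ^ S.card ≤ Real.exp (-(S.card * y)) := by
    have h5 : probMaxLE P ξ (cellCore t g 0) x ≤ Real.exp (-y) := by
      linarith [Real.add_one_le_exp (-y)]
    calc _ ≤ Real.exp (-y) ^ S.card := pow_le_pow_left₀ (probMaxLE_nonneg _ _) h5 _
      _ = _ := by
        rw [← Real.exp_nat_mul]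
        congr 1
        ring
  linarith [(abs_le.1 h1).2]

/-- The lower bound: the shrunk outer cells are nearly independent, and their margins contribute
at most the expected number of exceedances there. -/
theorem IsStationary.le_probMaxLE_latticePoints (hstat : IsStationary P ξ)
    (hξ : ∀ v, Measurable (ξ v)) {c : Fin d → ℝ} {k : ℕ}
    (ht : ∀ ℓ, 0 < boxSide c k ℓ) (hγ : ∀ ℓ, 0 < γ ℓ) (hg : ∀ ℓ, γ ℓ ≤ g ℓ)
    (hgt : ∀ ℓ, 2 * g ℓ ≤ boxSide c k ℓ)
    (hmix : ∀ A B : Set (Fin d → ℤ), A ⊆ K → B ⊆ K → IsSeparated γ A B → (IsBox A ∨ IsBox B) →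
      |probMaxLE P ξ (A ∪ B) x - probMaxLE P ξ A x * probMaxLE P ξ B x| ≤ α)
    (hK : outerApprox C c k ⊆ K) (hfin : (outerCells (boxSide c k) C).Finite) {δ : ℝ}
    (hδ : δ < 1) (hδ' : 1 - probMaxLE P ξ (cellPoints (boxSide c k) 0) x ≤ δ) :
    Real.exp (-((outerCells (boxSide c k) C).ncard * δ / (1 - δ))) -
      ((outerCells (boxSide c k) C).ncard * α + (outerCells (boxSide c k) C).ncard *
        (((∏ ℓ, (boxSide c k ℓ : ℝ)) - ∏ ℓ, ((boxSide c k ℓ : ℝ) - 2 * g ℓ)) *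
          P.real {ω | x < ξ 0 ω})) ≤
      probMaxLE P ξ (latticePoints C) x := by
  classical
  have hg0 : ∀ ℓ, 0 ≤ g ℓ := fun ℓ => by exact_mod_cast ((hγ ℓ).trans_le (hg ℓ)).le
  set t := boxSide c k
  rw [Set.ncard_eq_toFinset_card _ hfin]
  set S := hfin.toFinset
  have h1 := hstat.abs_probMaxLE_biUnion_cellCore_sub_le hξ hmix ht hγ hg S
    fun z hz => (cellPoints_subset_outerApprox (hfin.mem_toFinset.1 hz)).trans hK
  set B := S.biUnion fun z => cellPoints t z \ cellCore t g z
  have hB : (B.card : ℝ) ≤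
      S.card * ((∏ ℓ, (t ℓ : ℝ)) - ∏ ℓ, ((t ℓ : ℝ) - 2 * g ℓ)) := by
    have h := Nat.cast_le (α := ℝ) |>.2 (Finset.card_biUnion_le (s := S)
      (t := fun z => cellPoints t z \ cellCore t g z))
    refine h.trans (le_of_eq ?_)
    rw [Nat.cast_sum, Finset.sum_congr rfl fun z _ => ?_, Finset.sum_const, nsmul_eq_mul]
    rw [Finset.card_sdiff_of_subset (cellCore_subset hg0),
      Nat.cast_sub (Finset.card_le_card (cellCore_subset hg0)), card_cellPoints ht,
      card_cellCore hgt]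
  have h2 := hstat.probMaxLE_le_union hξ (S.biUnion (cellCore t g) : Finset (Fin d → ℤ)) B x
  have h3 : probMaxLE P ξ
      ((S.biUnion (cellCore t g) : Finset (Fin d → ℤ)) ∪ (B : Set (Fin d → ℤ))) x ≤
      probMaxLE P ξ (latticePoints C) x := by
    refine probMaxLE_anti (fun v hv => ?_) x
    obtain ⟨z, hz, hvz⟩ := Finset.mem_biUnion.1
      (Finset.mem_coe.1 (latticePoints_subset_biUnion ht hfin hv))
    by_cases hc : v ∈ cellCore t g z
    · exact Or.inl (Finset.mem_coe.2 (Finset.mem_biUnion.2 ⟨z, hz, hc⟩))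
    · exact Or.inr (Finset.mem_coe.2 (Finset.mem_biUnion.2
        ⟨z, hz, Finset.mem_sdiff.2 ⟨hvz, hc⟩⟩))
  have h4 : (1 - δ) ^ S.card ≤ probMaxLE P ξ (cellCore t g 0) x ^ S.card := by
    refine pow_le_pow_left₀ (by linarith) ?_ _
    have := probMaxLE_anti (P := P) (ξ := ξ) (Finset.coe_subset.2 (cellCore_subset (t := t) hg0
      (z := 0))) x
    linarith
  have h5 := exp_neg_le_one_sub_pow hδ S.card
  have h6 := mul_le_mul_of_nonneg_right hB
    (measureReal_nonneg (μ := P) (s := {ω | x < ξ 0 ω}))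
  linarith [(abs_le.1 h1).1]

end Comparison

theorem mem_surroundingBox {d : ℕ} {c : Fin d → ℝ} {b : ℝ} (hc : ∀ ℓ, 0 < c ℓ) {v : Fin d → ℤ}
    (h : ∀ ℓ, |(v ℓ : ℝ)| ≤ c ℓ * b) : v ∈ surroundingBox c b := by
  have key : ∀ ℓ, -b ≤ (v ℓ : ℝ) / c ℓ ∧ (v ℓ : ℝ) / c ℓ ≤ b := by
    intro ℓ
    have h1 := abs_le.1 (h ℓ)
    rw [le_div_iff₀ (hc ℓ), div_le_iff₀ (hc ℓ)]
    constructor <;> linarith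
  refine ⟨fun ℓ => (v ℓ : ℝ) / c ℓ, ⟨fun ℓ => (key ℓ).1, fun ℓ => (key ℓ).2⟩, ?_⟩
  funext ℓ
  exact mul_div_cancel₀ _ (hc ℓ).ne'

/-- The block `3J` around the origin fits into the surrounding box. -/
theorem eventually_Icc_subset_surroundingBox {d : ℕ} (hd : d ≠ 0) {c : ℕ → Fin d → ℝ} {k : ℕ → ℕ}
    (hc : ∀ n ℓ, 0 < c n ℓ) {b : ℝ} (hb : 0 < b) (hk : Tendsto k atTop atTop) :
    ∀ᶠ n in atTop, Set.Icc (fun ℓ => -boxSide (c n) (k n) ℓ)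
      (fun ℓ => 2 * boxSide (c n) (k n) ℓ - 1) ⊆ surroundingBox (c n) b := by
  filter_upwards [(tendsto_natRoot_atTop hd hk).eventually_ge_atTop (2 / b)] with n hn v hv
  refine mem_surroundingBox (hc n) fun ℓ => ?_
  have hκ0 : 0 < (k n : ℝ) ^ (1 / (d : ℝ)) := (by positivity : 0 < 2 / b).trans_le hn
  have h1 : (boxSide (c n) (k n) ℓ : ℝ) ≤ c n ℓ / (k n : ℝ) ^ (1 / (d : ℝ)) := Int.floor_le _
  have h2 : 2 * (c n ℓ / (k n : ℝ) ^ (1 / (d : ℝ))) ≤ c n ℓ * b := by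
    rw [div_le_iff₀ hb] at hn
    rw [← mul_div_assoc, div_le_iff₀ hκ0]
    nlinarith [hc n ℓ]
  have h3 : -(boxSide (c n) (k n) ℓ : ℝ) ≤ v ℓ := by exact_mod_cast hv.1 ℓ
  have h4 : (v ℓ : ℝ) ≤ 2 * boxSide (c n) (k n) ℓ - 1 := by exact_mod_cast hv.2 ℓ
  have h5 : 0 < c n ℓ / (k n : ℝ) ^ (1 / (d : ℝ)) := div_pos (hc n ℓ) hκ0
  exact abs_le.2 ⟨by linarith, by linarith⟩

/-! ### From block bounds to the limit -/

/-- The analytic core: block bounds for `F` in terms of the numbers `N⁻`, `N⁺` of cells, the sizes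
`T` of a cell and `T'` of its core, the size `a` of the index set, and the exceedance probability
`q` determine the limit of `F` from that of `a q`, and conversely. -/
theorem tendsto_iff_of_block_bounds {F a q T T' Θ α : ℕ → ℝ} {Nm Np k : ℕ → ℕ} {r θ τ : ℝ}
    (ha : ∀ n, 0 ≤ a n) (hq : ∀ n, 0 ≤ q n) (hθ : 0 < θ) (hk : Tendsto k atTop atTop)
    (hT : ∀ᶠ n in atTop, 0 < T n)
    (hNm : Tendsto (fun n => (Nm n : ℝ) / k n) atTop (𝓝 1))
    (hNp : Tendsto (fun n => (Np n : ℝ) / k n) atTop (𝓝 1))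
    (haT : Tendsto (fun n => a n / (k n * T n)) atTop (𝓝 1))
    (hT' : Tendsto (fun n => T' n / T n) atTop (𝓝 1))
    (hΘ : Tendsto Θ atTop (𝓝 θ)) (hα : Tendsto (fun n => (k n : ℝ) * α n) atTop (𝓝 0))
    (hupper : ∀ᶠ n in atTop,
      F n ≤ Real.exp (-(Nm n * (T' n * (Θ n * q n)))) + Nm n * α n)
    (hlower : ∀ᶠ n in atTop, ∀ δ < 1,
      T n * (Θ n * q n) + (T n - T' n) * q n + (T n * q n) * (r * (T n * q n)) + α n ≤ δ →
      Real.exp (-(Np n * δ / (1 - δ))) - (Np n * α n + Np n * ((T n - T' n) * q n)) ≤ F n) :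
    Tendsto (fun n => a n * q n) atTop (𝓝 τ) ↔ Tendsto F atTop (𝓝 (Real.exp (-(θ * τ)))) := by
  set s : ℕ → ℝ := fun n => a n * q n with hs_def
  have hs0 : ∀ n, 0 ≤ s n := fun n => mul_nonneg (ha n) (hq n)
  have hk0 : ∀ᶠ n in atTop, (0 : ℝ) < k n := by
    filter_upwards [hk.eventually_gt_atTop 0] with n hn
    exact_mod_cast hn
  have ha0 : ∀ᶠ n in atTop, a n ≠ 0 := by
    filter_upwards [haT.eventually_ne one_ne_zero] with n hn h0
    exact hn (by rw [h0, zero_div])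
  have hmul : ∀ {N : ℕ → ℕ}, Tendsto (fun n => (N n : ℝ) / k n) atTop (𝓝 1) →
      Tendsto (fun n => (N n : ℝ) * α n) atTop (𝓝 0) := by
    intro N hN
    have h := hN.mul hα
    rw [mul_zero] at h
    refine h.congr' ?_
    filter_upwards [hk0] with n hn
    field_simp
  have hratio : ∀ {N : ℕ → ℕ}, Tendsto (fun n => (N n : ℝ) / k n) atTop (𝓝 1) →
      Tendsto (fun n => (N n : ℝ) * T n / a n) atTop (𝓝 1) := by
    intro N hN
    have h := hN.div haT one_ne_zero
    rw [div_one] at h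
    refine h.congr' ?_
    filter_upwards [hk0, hT, ha0] with n hn hTn han
    simp only [Pi.div_apply]
    field_simp
  have hNpT : Tendsto Np atTop atTop := by
    rw [← tendsto_natCast_atTop_iff (R := ℝ)]
    refine (hNp.pos_mul_atTop one_pos (tendsto_natCast_atTop_atTop.comp hk)).congr' ?_
    filter_upwards [hk0] with n hn
    simp only [Function.comp_apply]
    field_simp
  have hNpinv : Tendsto (fun n => (Np n : ℝ)⁻¹) atTop (𝓝 0) :=
    tendsto_inv_atTop_zero.comp (tendsto_natCast_atTop_atTop.comp hNpT)
  have hT'1 : Tendsto (fun n => 1 - T' n / T n) atTop (𝓝 0) := by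
    simpa using hT'.const_sub 1
  -- The exponent of the upper bound is `s u`.
  have hu : Tendsto (fun n => (Nm n : ℝ) * T n / a n * (T' n / T n) * Θ n) atTop (𝓝 θ) := by
    simpa using ((hratio hNm).mul hT').mul hΘ
  have hupper' : ∀ᶠ n in atTop, F n ≤
      Real.exp (-(s n * ((Nm n : ℝ) * T n / a n * (T' n / T n) * Θ n))) + Nm n * α n := by
    filter_upwards [hupper, hT, ha0] with n h hTn han
    convert h using 4
    simp only [hs_def]
    field_simp
  -- As soon as `s` is bounded, `F` is asymptotically `exp (-θ s)`.
  have hmain : s =O[atTop] (fun _ => (1 : ℝ)) →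
      Tendsto (fun n => F n - Real.exp (-(θ * s n))) atTop (𝓝 0) := by
    intro hs
    set w : ℕ → ℝ := fun n => (Np n : ℝ) * T n / a n with hw_def
    have hw : Tendsto w atTop (𝓝 1) := hratio hNp
    have hmargin : Tendsto (fun n => s n * (w n * (1 - T' n / T n))) atTop (𝓝 0) :=
      tendsto_mul_zero_of_isBigO_one hs (by simpa using hw.mul hT'1)
    have hmargin_eq : ∀ᶠ n in atTop,
        s n * (w n * (1 - T' n / T n)) = Np n * ((T n - T' n) * q n) := by
      filter_upwards [hT, ha0] with n hTn han
      simp only [hs_def, hw_def]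
      field_simp
    set δ : ℕ → ℝ := fun n =>
      T n * (Θ n * q n) + (T n - T' n) * q n + (T n * q n) * (r * (T n * q n)) + α n with hδ_def
    have hNδ : Tendsto (fun n => Np n * δ n - θ * s n) atTop (𝓝 0) := by
      have h1 : Tendsto (fun n => s n * (w n * Θ n - θ)) atTop (𝓝 0) :=
        tendsto_mul_zero_of_isBigO_one hs (by simpa using (hw.mul hΘ).sub_const θ)
      have h2 : Tendsto (fun n => s n * (s n * (w n ^ 2 * r * (Np n : ℝ)⁻¹))) atTop (𝓝 0) := by
        refine tendsto_mul_zero_of_isBigO_one hs (tendsto_mul_zero_of_isBigO_one hs ?_)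
        simpa using ((hw.pow 2).mul_const r).mul hNpinv
      have h3 := ((h1.add hmargin).add h2).add (hmul hNp)
      simp only [add_zero] at h3
      refine h3.congr' ?_
      filter_upwards [hT, ha0, hmargin_eq, hNpT.eventually_gt_atTop 0] with n hTn han hm hN
      have hN0 : (Np n : ℝ) ≠ 0 := by exact_mod_cast hN.ne'
      rw [hm]
      simp only [hs_def, hw_def, hδ_def]
      field_simp
      ring
    obtain ⟨hδ, hexp⟩ := tendsto_exp_neg_div_one_sub (fun n => mul_nonneg hθ.le (hs0 n))
      (hs.const_mul_left θ) hNpT hNδ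
    have hlow := hexp.sub ((hmul hNp).add hmargin)
    have hup : Tendsto (fun n =>
        (Real.exp (-(s n * ((Nm n : ℝ) * T n / a n * (T' n / T n) * Θ n))) -
          Real.exp (-(θ * s n))) + Nm n * α n) atTop (𝓝 (0 + 0)) := by
      refine (tendsto_exp_neg_sub_exp_neg (fun n => mul_nonneg hθ.le (hs0 n)) ?_).add (hmul hNm)
      refine (tendsto_mul_zero_of_isBigO_one hs (e := fun n =>
        (Nm n : ℝ) * T n / a n * (T' n / T n) * Θ n - θ) (by simpa using hu.sub_const θ)).congr
        fun n => ?_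
      ring
    simp only [add_zero, sub_zero] at hlow hup
    refine tendsto_of_tendsto_of_tendsto_of_le_of_le' hlow hup ?_ ?_
    · filter_upwards [hlower, hδ.eventually_lt_const one_pos, hmargin_eq] with n hn hδn hm
      have := hn (δ n) hδn le_rfl
      rw [hm]
      linarith
    · filter_upwards [hupper'] with n hn
      linarith
  constructor
  · intro h
    have h1 := hmain (h.isBigO_one ℝ)
    have h2 : Tendsto (fun n => Real.exp (-(θ * s n))) atTop (𝓝 (Real.exp (-(θ * τ)))) :=
      (Real.continuous_exp.tendsto _).comp (h.const_mul θ).neg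
    simpa using h1.add h2
  · intro h
    have h1 := hmain (isBigO_one_of_le_exp hs0 hθ (Real.exp_pos _) hu (hmul hNm) h hupper')
    have h2 : Tendsto (fun n => Real.exp (-(θ * s n))) atTop (𝓝 (Real.exp (-(θ * τ)))) := by
      simpa using h.sub h1
    have h3 := (h2.log (Real.exp_pos _).ne').const_mul (-θ⁻¹)
    simp only [Real.log_exp] at h3
    have h4 : ∀ y : ℝ, -θ⁻¹ * -(θ * y) = y := fun y => by field_simp
    simpa only [h4] using h3

end SpatialExtremes

theorem theorem3p5 {d p : ℕ} {Ω : Type*} [MeasurableSpace Ω] (P : Measure Ω)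
    [IsProbabilityMeasure P]
    (ξ : (Fin d → ℤ) → Ω → ℝ) (hξ : ∀ v, Measurable (ξ v))
    (hstat : SpatialExtremes.IsStationary P ξ)
    (D : ℕ → Set (Fin d → ℤ)) (C : ℕ → Set (Fin d → ℝ)) (c : ℕ → Fin d → ℝ)
    (hD : SpatialExtremes.GeometricAssumption p D C c)
    (prec : (Fin d → ℤ) → (Fin d → ℤ) → Prop)
    (hprec : SpatialExtremes.IsTranslationInvariantOrder prec)
    (k : ℕ → ℕ) (b : ℝ) (hb : 0 < b)
    (hK : ∀ n, SpatialExtremes.outerApprox (C n) (c n) (k n) ⊆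
      SpatialExtremes.surroundingBox (c n) b)
    (x : ℕ → ℝ) (γ : ℕ → Fin d → ℝ) (α : ℕ → ℝ)
    (hmix : SpatialExtremes.MixingCondition P ξ c x
      (fun n => SpatialExtremes.surroundingBox (c n) b) γ α)
    (hk : Tendsto k atTop atTop)
    (hkα : Tendsto (fun n => (k n : ℝ) * α n) atTop (𝓝 0))
    (hkγ : ∀ ℓ, (fun n => (k n : ℝ) ^ (1 / (d : ℝ)) * γ n ℓ) =o[atTop] (fun n => c n ℓ))
    (θ : ℝ) (hθ : θ ∈ Set.Ioc (0 : ℝ) 1)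
    (hloc : SpatialExtremes.LocalCondition P ξ prec c x k θ)
    (τ : ℝ) (hτ : 0 ≤ τ) :
    Tendsto (fun n => ((D n).ncard : ℝ) * P.real {ω | x n < ξ 0 ω}) atTop (𝓝 τ) ↔
      Tendsto (fun n => SpatialExtremes.probMaxLE P ξ (D n) (x n)) atTop
        (𝓝 (Real.exp (-(θ * τ)))) := by
  open SpatialExtremes in
  have hct := fun ℓ => tendsto_div_root_atTop hmix.gap_pos hmix.gap_mono hD.scaling_pos hk ℓ (hkγ ℓ)
  have htpos := eventually_boxSide_pos hct
  have hgt := fun ℓ => tendsto_ceil_gap_div_boxSide hmix.gap_pos (hct ℓ) (hkγ ℓ)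
  have hg : ∀ n ℓ, γ n ℓ ≤ (⌈γ n ℓ⌉ : ℝ) := fun n ℓ => Int.le_ceil _
  have hg2 : ∀ᶠ n in atTop, ∀ ℓ, 2 * ⌈γ n ℓ⌉ ≤ boxSide (c n) (k n) ℓ := by
    have h : ∀ᶠ n in atTop, ∀ ℓ, (⌈γ n ℓ⌉ : ℝ) / boxSide (c n) (k n) ℓ < 1 / 2 :=
      eventually_all.2 fun ℓ => (hgt ℓ).eventually_lt_const (by norm_num)
    filter_upwards [h, htpos] with n hn ht ℓ
    have h1 := hn ℓ
    rw [div_lt_iff₀ (by exact_mod_cast ht ℓ)] at h1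
    have h2 : 2 * (⌈γ n ℓ⌉ : ℝ) ≤ boxSide (c n) (k n) ℓ := by linarith
    exact_mod_cast h2
  have hfin := hD.eventually_finite_outerCells hk hct
  refine tendsto_iff_of_block_bounds (k := k) (r := 3 ^ d)
    (T := fun n => ∏ ℓ, (boxSide (c n) (k n) ℓ : ℝ))
    (T' := fun n => ∏ ℓ, ((boxSide (c n) (k n) ℓ : ℝ) - 2 * ⌈γ n ℓ⌉))
    (Nm := fun n => (innerCells (boxSide (c n) (k n)) (C n)).ncard)
    (Np := fun n => (outerCells (boxSide (c n) (k n)) (C n)).ncard)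
    (fun n => Nat.cast_nonneg _) (fun n => measureReal_nonneg) hθ.1 hk ?_
    (hD.tendsto_ncard_innerCells_div hk hct) (hD.tendsto_ncard_outerCells_div hk hct)
    (hD.tendsto_ncard_div hk hct) (tendsto_prod_sub_div_prod hgt htpos) hloc.tendsto hkα ?_ ?_
  · filter_upwards [htpos] with n ht
    exact Finset.prod_pos fun ℓ _ => by exact_mod_cast ht ℓ
  · filter_upwards [htpos, hg2, hfin] with n ht hgn hfinn
    rw [probMaxLE_cond_mul hξ, hD.index_eq n]
    exact hstat.probMaxLE_latticePoints_le hξ hprec ht (hmix.gap_pos n) (hg n) hgn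
      (hmix.mixing n) (hK n) hfinn
  · filter_upwards [htpos, hg2, hfin,
      eventually_Icc_subset_surroundingBox hD.dim_ne_zero hD.scaling_pos hb hk]
      with n ht hgn hfinn hKt δ hδ1 hδ
    rw [probMaxLE_cond_mul hξ] at hδ
    rw [hD.index_eq n]
    exact hstat.le_probMaxLE_latticePoints hξ ht (hmix.gap_pos n) (hg n) hgn (hmix.mixing n)
      (hK n) hfinn hδ1 ((hstat.one_sub_probMaxLE_cellPoints_le hξ hprec ht (hmix.gap_pos n) (hg n)
        hgn (hmix.mixing n) hKt rfl rfl).trans hδ)
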